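/- Let $n\ge 0$ be an integer and let $\mathcal K(n)\subset \mathbb C(S_n)^{\otimes 3}$ be the algebra of elements invariant under left and right multiplication by $\gamma\otimes\gamma\otimes\gamma$ for all $\gamma\in S_n$. Let $\mathcal K_{Y_0}(n)\subset\mathcal K(n)$ be the subalgebra of elements that are also invariant under the action of $S_3$ permuting the three tensor slots (these algebras have the unit $\frac1{n!}\sum_\gamma\gamma\otimes\gamma\otimes\gamma$). Let $R,S,T$ run over a complete list of pairwise inequivalent irreducible complex representations $V_R$ of $S_n$ and let $\Lambda$ run over those of $S_3$, each given by unitary (for instance real orthogonal) matrices $D^R_{ij}(\sigma)$, $D^\Lambda_{pm}(\alpha)$. Write $\mathrm{Mult}(W,V)$ for the multiplicity of an irreducible representation $V$ in $W$, let $\mathsf C(R,S,T)=\mathrm{Mult}(V_R\otimes V_S,V_T)$ be the Kronecker coefficient, let $V_{[n]}$ be the trivial representation of $S_n$, and regard $V_R^{\otimes 3}$ as a representation of $S_n\times S_3$, with $S_n$ acting diagonally and $S_3$ permuting the factors. 1. One has $$\dim \mathcal K_{Y_0}(n)=\sum_{\{R,S,T\}}\mathsf C(R,S,T)^2+\sum_{R\ne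 S}\Big[\mathrm{Mult}(\mathrm{Sym}^2V_R,V_S)^2+\mathrm{Mult}(\Lambda^2V_R,V_S)^2\Big]+\sum_R\sum_{\Lambda}\mathrm{Mult}\big(V_R^{\otimes 3},V_{[n]}\otimes V_\Lambda\big)^2,$$ where the first sum is over unordered triples of pairwise distinct irreducible representations and the second over ordered pairs $(R,S)$ with $R\neq S$. 2. There exist orthonormal Clebsch–Gordan coefficients of the following four kinds, with the multiplicity index $\tau$ running over a set whose cardinality is the corresponding multiplicity in part 1: an orthonormal basis $C^\tau_{i_1i_2i_3}$ of the $S_n$-invariant vectors in $V_R\otimes V_S\otimes V_T$ for each $\{R,S,T\}$; of those in $\mathrm{Sym}^2V_R\otimes V_S$ and of those in $\Lambda^2V_R\otimes V_S$ for each $R\neq S$; and, for each $R$, an orthonormal basis $C^{\Lambda,\tau,m}_{i_1i_2i_3}$ $(1\le m\le\dim V_\Lambda)$ of the $S_n$-invariant vectors in $V_R^{\otimes3}$, such that for fixed $\Lambda,\tau$ every $\alpha\in S_3$ maps $C^{\Lambda,\tau,m}$ to $\sum_p D^\Lambda_{pm}(\alpha)\,C^{\Lambda,\tau,p}$. 3.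 Put $Q^R_{ij}=\frac{\dim V_R}{n!}\sum_\sigma\overline{D^R_{ij}(\sigma)}\,\sigma$. For every choice of coefficients as in part 2, the elements $$\sum_{i,j}C^{\tau_1}_{i_1i_2i_3}\overline{C^{\tau_2}_{j_1j_2j_3}}\sum_{\alpha\in S_3}\alpha\cdot\big(Q^R_{i_1j_1}\otimes Q^S_{i_2j_2}\otimes Q^T_{i_3j_3}\big)\qquad(\{R,S,T\}),$$ $$\sum_{i,j}C^{\tau_1}_{i_1i_2i_3}\overline{C^{\tau_2}_{j_1j_2j_3}}\big(Q^R_{i_1j_1}\otimes Q^R_{i_2j_2}\otimes Q^S_{i_3j_3}+Q^R_{i_1j_1}\otimes Q^S_{i_3j_3}\otimes Q^R_{i_2j_2}+Q^S_{i_3j_3}\otimes Q^R_{i_1j_1}\otimes Q^R_{i_2j_2}\big)$$ (for $R\ne S$, with both coefficients of the $\mathrm{Sym}^2$ kind or both of the $\Lambda^2$ kind), and $$\sum_{i,j,m}C^{\Lambda,\tau_1,m}_{i_1i_2i_3}\overline{C^{\Lambda,\tau_2,m}_{j_1j_2j_3}}\;Q^R_{i_1j_1}\otimes Q^R_{i_2j_2}\otimes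 Q^R_{i_3j_3}\qquad(R,\Lambda)$$ form a basis of $\mathcal K_{Y_0}(n)$, and there is an algebra isomorphism from $\mathcal K_{Y_0}(n)$ onto the direct product of full matrix algebras over $\mathbb C$, one for each square in the sum of part 1 and of the size being squared, which sends the basis element with indices $\tau_1,\tau_2$ to the matrix unit $E_{\tau_1\tau_2}$ of the corresponding factor. -/

import Mathlib

open scoped TensorProduct ComplexConjugate

noncomputable section

namespace ColourSym

/-! ### Complete systems of irreducible representations, in orthonormal bases -/

/-- The representation on column vectors given by a homomorphism to unitary matrices. -/
def unitaryRep {G : Type*} [Group G] {d : ℕ} (D : G →* Matrix.unitaryGroup (Fin d) ℂ) :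
    Representation ℂ G (Fin d → ℂ) where
  toFun g := Matrix.toLin' (D g : Matrix (Fin d) (Fin d) ℂ)
  map_one' := by simp; rfl
  map_mul' g h := by simp [Matrix.toLin'_mul]; rfl

/-- A complete list, indexed by `ι`, of pairwise inequivalent irreducible complex representations
of `G`, each given by unitary matrices `D R g` in a chosen orthonormal basis. For symmetric groups
the matrices (and Clebsch-Gordan coefficients) may be chosen real; all complex conjugations below
are then vacuous. -/
structure IrrepSystem (G : Type*) [Group G] (ι : Type*) where
  dim : ι → ℕ
  D : ∀ R : ι, G →* Matrix.unitaryGroup (Fin (dim R)) ℂ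
  irreducible : ∀ R, (unitaryRep (D R)).IsIrreducible
  inequivalent : ∀ R S, Nonempty ((unitaryRep (D R)).Equiv (unitaryRep (D S))) → R = S
  complete : ∀ (m : ℕ) (ρ : Representation ℂ G (Fin m → ℂ)), ρ.IsIrreducible →
    ∃ R, Nonempty (ρ.Equiv (unitaryRep (D R)))

/-- The representation `V_R`. -/
abbrev IrrepSystem.rep {G ι : Type*} [Group G] (X : IrrepSystem G ι) (R : ι) :
    Representation ℂ G (Fin (X.dim R) → ℂ) :=
  unitaryRep (X.D R)

/-- The matrix entry `D^R_{ij}(g)`. -/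
abbrev IrrepSystem.entry {G ι : Type*} [Group G] (X : IrrepSystem G ι) (R : ι) (g : G)
    (i j : Fin (X.dim R)) : ℂ :=
  (X.D R g : Matrix (Fin (X.dim R)) (Fin (X.dim R)) ℂ) i j

/-! ### Multiplicities -/

/-- `Mult(W, V)`: the multiplicity of the irreducible representation `V` in `W`, i.e. the
dimension of the space of equivariant maps `V → W`. -/
def mult {G W V : Type*} [Group G] [AddCommMonoid W] [Module ℂ W] [AddCommMonoid V] [Module ℂ V]
    (σ : Representation ℂ G W) (ρ : Representation ℂ G V) : ℕ :=
  Module.finrank ℂ (Representation.IntertwiningMap ρ σ)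

/-- `Sym² V`, as the subrepresentation of `V ⊗ V` of tensors fixed by the flip. -/
def symSq {G V : Type*} [Group G] [AddCommGroup V] [Module ℂ V] (ρ : Representation ℂ G V) :
    Subrepresentation (ρ.tprod ρ) where
  toSubmodule := LinearMap.ker ((TensorProduct.comm ℂ V V).toLinearMap - LinearMap.id)
  apply_mem_toSubmodule g v hv := by
    have key : ∀ t : V ⊗[ℂ] V, TensorProduct.comm ℂ V V (ρ.tprod ρ g t) =
        ρ.tprod ρ g (TensorProduct.comm ℂ V V t) := fun t => by
      induction t with
      | zero => simp
      | tmul x y => simp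
      | add x y hx hy => simp only [map_add, hx, hy]
    simp only [LinearMap.mem_ker, LinearMap.sub_apply, LinearEquiv.coe_coe, LinearMap.id_apply,
      sub_eq_zero] at hv ⊢
    rw [key, hv]

/-- `Λ² V`, as the subrepresentation of `V ⊗ V` of tensors negated by the flip. -/
def altSq {G V : Type*} [Group G] [AddCommGroup V] [Module ℂ V] (ρ : Representation ℂ G V) :
    Subrepresentation (ρ.tprod ρ) where
  toSubmodule := LinearMap.ker ((TensorProduct.comm ℂ V V).toLinearMap + LinearMap.id)
  apply_mem_toSubmodule g v hv := by
    have key : ∀ t : V ⊗[ℂ] V, TensorProduct.comm ℂ V V (ρ.tprod ρ g t) =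
        ρ.tprod ρ g (TensorProduct.comm ℂ V V t) := fun t => by
      induction t with
      | zero => simp
      | tmul x y => simp
      | add x y hx hy => simp only [map_add, hx, hy]
    simp only [LinearMap.mem_ker, LinearMap.add_apply, LinearEquiv.coe_coe, LinearMap.id_apply,
      add_eq_zero_iff_eq_neg] at hv ⊢
    rw [key, hv, map_neg]

/-- `V^{⊗3}` as a representation of `G × S₃`: `G` acts diagonally and `S₃` permutes the three
tensor factors. -/
def tensorCube {G V : Type*} [Group G] [AddCommGroup V] [Module ℂ V] (ρ : Representation ℂ G V) :
    Representation ℂ (G × Equiv.Perm (Fin 3)) (⨂[ℂ] _ : Fin 3, V) where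
  toFun p := PiTensorProduct.map (fun _ => ρ p.1) ∘ₗ
    (PiTensorProduct.reindex ℂ (fun _ : Fin 3 => V) p.2).toLinearMap
  map_one' := by
    apply PiTensorProduct.ext
    ext v
    simp [PiTensorProduct.reindex_tprod, PiTensorProduct.map_tprod]
    rfl
  map_mul' p q := by
    apply PiTensorProduct.ext
    ext v
    simp [PiTensorProduct.reindex_tprod]
    rfl

/-- The representation `V_{[n]} ⊗ V_Λ` of `G × S₃`, with `V_{[n]}` the one-dimensional trivial
representation of `G` and `V_Λ` a representation of `S₃`. -/
def trivialBox (G : Type*) {V : Type*} [Group G] [AddCommGroup V] [Module ℂ V]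
    (lam : Representation ℂ (Equiv.Perm (Fin 3)) V) :
    Representation ℂ (G × Equiv.Perm (Fin 3)) (ℂ ⊗[ℂ] V) :=
  Representation.tprod
    ((Representation.trivial ℂ G ℂ).comp (MonoidHom.fst G (Equiv.Perm (Fin 3))))
    (lam.comp (MonoidHom.snd G (Equiv.Perm (Fin 3))))

section Mults

variable {G ι κ : Type*} [Group G] (X : IrrepSystem G ι)
  (Y : IrrepSystem (Equiv.Perm (Fin 3)) κ)

/-- The Kronecker coefficient `C(R,S,T)`: the multiplicity of `V_T` in `V_R ⊗ V_S`. -/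
def kron (R S T : ι) : ℕ := mult ((X.rep R).tprod (X.rep S)) (X.rep T)

/-- `Mult(Sym² V_R, V_S)`. -/
def multSym (R S : ι) : ℕ := mult (symSq (X.rep R)).toRepresentation (X.rep S)

/-- `Mult(Λ² V_R, V_S)`. -/
def multAlt (R S : ι) : ℕ := mult (altSq (X.rep R)).toRepresentation (X.rep S)

/-- `Mult(V_R^{⊗3}, V_{[n]} ⊗ V_Λ)`. -/
def multCube (R : ι) (L : κ) : ℕ := mult (tensorCube (X.rep R)) (trivialBox G (Y.rep L))

end Mults

/-! ### The colour-symmetric algebra -/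

/-- The algebra `ℂ(S_n) ⊗ ℂ(S_n) ⊗ ℂ(S_n)`, realised as the group algebra of `S_n × S_n × S_n`:
`σ₁ ⊗ σ₂ ⊗ σ₃` is the basis element of the triple `(σ₁, σ₂, σ₃)`. -/
abbrev Tri (n : ℕ) : Type := MonoidAlgebra ℂ (Fin 3 → Equiv.Perm (Fin n))

/-- `a ⊗ b ⊗ c`. -/
def tri {n : ℕ} (a b c : MonoidAlgebra ℂ (Equiv.Perm (Fin n))) : Tri n :=
  ∑ s : Fin 3 → Equiv.Perm (Fin n),
    (a.coeff (s 0) * b.coeff (s 1) * c.coeff (s 2)) • MonoidAlgebra.of ℂ _ s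

/-- `γ ⊗ γ ⊗ γ`. -/
def diag {n : ℕ} (g : Equiv.Perm (Fin n)) : Tri n :=
  MonoidAlgebra.of ℂ _ (fun _ : Fin 3 => g)

/-- The action of `S₃` permuting the tensor slots: the factor in slot `k` moves to slot `a k`. -/
def colour {n : ℕ} (a : Equiv.Perm (Fin 3)) : Tri n ≃ₐ[ℂ] Tri n :=
  MonoidAlgebra.domCongr ℂ ℂ (MulEquiv.arrowCongr a (MulEquiv.refl (Equiv.Perm (Fin n))))

/-- `𝒦(n)`: the elements of `ℂ(S_n)^{⊗3}` invariant under left and right multiplication by the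
diagonally embedded `S_n`. -/
def K (n : ℕ) : NonUnitalSubalgebra ℂ (Tri n) where
  carrier := {x | (∀ g, diag g * x = x) ∧ ∀ g, x * diag g = x}
  add_mem' {x y} hx hy := ⟨fun g => by rw [mul_add, hx.1, hy.1],
    fun g => by rw [add_mul, hx.2, hy.2]⟩
  zero_mem' := ⟨fun g => mul_zero _, fun g => zero_mul _⟩
  mul_mem' {x y} hx hy := ⟨fun g => by rw [← mul_assoc, hx.1], fun g => by rw [mul_assoc, hy.2]⟩
  smul_mem' c x hx := ⟨fun g => by rw [mul_smul_comm, hx.1],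
    fun g => by rw [smul_mul_assoc, hx.2]⟩

/-- `𝒦_{Y₀}(n)`: the subalgebra of `𝒦(n)` of elements invariant under all permutations of the
three tensor slots. Like `𝒦(n)` it has its own unit `(1/n!) ∑ γ ⊗ γ ⊗ γ`. -/
def KSym (n : ℕ) : NonUnitalSubalgebra ℂ (Tri n) where
  carrier := {x | x ∈ K n ∧ ∀ a, colour a x = x}
  add_mem' {x y} hx hy := ⟨add_mem hx.1 hy.1, fun a => by rw [map_add, hx.2, hy.2]⟩
  zero_mem' := ⟨zero_mem _, fun a => map_zero _⟩
  mul_mem' {x y} hx hy := ⟨mul_mem hx.1 hy.1, fun a => by rw [map_mul, hx.2, hy.2]⟩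
  smul_mem' c x hx := ⟨SMulMemClass.smul_mem c hx.1, fun a => by rw [map_smul, hx.2]⟩

/-! ### Blocks -/

/-- Labels of the blocks. `three R S T` stands for the unordered triple of distinct irreps
`{R, S, T}`, listed in increasing order for the chosen total order on labels. -/
inductive Block (ι κ : Type*) [LinearOrder ι]
  | three (R S T : ι) (h : R < S ∧ S < T)
  | sym (R S : ι) (h : R ≠ S)
  | alt (R S : ι) (h : R ≠ S)
  | cube (R : ι) (L : κ)

/-- The size of the matrix block with a given label. -/
def blockSize {G ι κ : Type*} [Group G] [LinearOrder ι] (X : IrrepSystem G ι)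
    (Y : IrrepSystem (Equiv.Perm (Fin 3)) κ) : Block ι κ → ℕ
  | .three R S T _ => kron X R S T
  | .sym R S _ => multSym X R S
  | .alt R S _ => multAlt X R S
  | .cube R L => multCube X Y R L

/-! ### Clebsch-Gordan coefficients -/

section CG

variable {G ι : Type*} [Group G] (X : IrrepSystem G ι)

/-- Arrays `c_{i₁ i₂ i₃}` of coordinates of vectors of `V_R ⊗ V_S ⊗ V_T`, with the standard
Hermitian inner product. -/
abbrev Arr (R S T : ι) : Type :=
  EuclideanSpace ℂ (Fin (X.dim R) × Fin (X.dim S) × Fin (X.dim T))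

/-- The vectors of `V_R ⊗ V_S ⊗ V_T` invariant under the diagonal action of `G`. -/
def inv3 (R S T : ι) : Submodule ℂ (Arr X R S T) where
  carrier := {c | ∀ g i, ∑ j, X.entry R g i.1 j.1 * X.entry S g i.2.1 j.2.1 *
    X.entry T g i.2.2 j.2.2 * c j = c i}
  add_mem' {c d} hc hd g i := by
    simp only [PiLp.add_apply, mul_add, Finset.sum_add_distrib, hc g i, hd g i]
  zero_mem' g i := by simp
  smul_mem' z c hc g i := by
    simp only [PiLp.smul_apply, smul_eq_mul]
    rw [← hc g i, Finset.mul_sum]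
    exact Finset.sum_congr rfl fun j _ => by ring

/-- The invariant vectors of `Sym² V_R ⊗ V_S`. -/
def invSym (R S : ι) : Submodule ℂ (Arr X R R S) where
  carrier := {c | c ∈ inv3 X R R S ∧ ∀ i j k, c (j, i, k) = c (i, j, k)}
  add_mem' {c d} hc hd := ⟨add_mem hc.1 hd.1, fun i j k => by
    simp only [PiLp.add_apply, hc.2 i j k, hd.2 i j k]⟩
  zero_mem' := ⟨zero_mem _, fun i j k => rfl⟩
  smul_mem' z c hc := ⟨Submodule.smul_mem _ z hc.1, fun i j k => by
    simp only [PiLp.smul_apply, hc.2 i j k]⟩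

/-- The invariant vectors of `Λ² V_R ⊗ V_S`. -/
def invAlt (R S : ι) : Submodule ℂ (Arr X R R S) where
  carrier := {c | c ∈ inv3 X R R S ∧ ∀ i j k, c (j, i, k) = -c (i, j, k)}
  add_mem' {c d} hc hd := ⟨add_mem hc.1 hd.1, fun i j k => by
    simp only [PiLp.add_apply, hc.2 i j k, hd.2 i j k, neg_add]⟩
  zero_mem' := ⟨zero_mem _, fun i j k => by simp⟩
  smul_mem' z c hc := ⟨Submodule.smul_mem _ z hc.1, fun i j k => by
    simp only [PiLp.smul_apply, hc.2 i j k, smul_neg]⟩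

/-- Orthonormal Clebsch-Gordan coefficients of the four kinds.
* `three`: coupling `V_R ⊗ V_S ⊗ V_T` to the trivial representation, for distinct `R, S, T`;
* `sym`, `alt`: coupling `Sym² V_R ⊗ V_S`, respectively `Λ² V_R ⊗ V_S`, to the trivial
  representation;
* `cube`: coupling `V_R^{⊗3}` to `V_{[n]} ⊗ V_Λ` under `G × S₃`; the label is
  `⟨Λ, (τ, m)⟩` with `τ` the multiplicity index and `m` the index of a basis vector of `V_Λ`,
  and for fixed `Λ, τ` the vectors transform under `S₃` with the matrices `D^Λ`. -/
structure CGSystem {κ : Type*} [LinearOrder ι] [Fintype κ]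
    (Y : IrrepSystem (Equiv.Perm (Fin 3)) κ) where
  three : ∀ R S T : ι, R < S → S < T →
    OrthonormalBasis (Fin (kron X R S T)) ℂ (inv3 X R S T)
  sym : ∀ R S : ι, R ≠ S → OrthonormalBasis (Fin (multSym X R S)) ℂ (invSym X R S)
  alt : ∀ R S : ι, R ≠ S → OrthonormalBasis (Fin (multAlt X R S)) ℂ (invAlt X R S)
  cube : ∀ R : ι, OrthonormalBasis
    (Σ L : κ, Fin (multCube X Y R L) × Fin (Y.dim L)) ℂ (inv3 X R R R)
  cube_equivariant : ∀ (R : ι) (L : κ) (t : Fin (multCube X Y R L)) (m : Fin (Y.dim L))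
    (a : Equiv.Perm (Fin 3)) (i : Fin 3 → Fin (X.dim R)),
    (cube R ⟨L, t, m⟩ : Arr X R R R) (i (a 0), i (a 1), i (a 2)) =
      ∑ p, Y.entry L a p m * (cube R ⟨L, t, p⟩ : Arr X R R R) (i 0, i 1, i 2)

end CG

/-! ### The refined Clebsch-Gordan basis -/

section Basis

variable {n : ℕ} {ι κ : Type*} (X : IrrepSystem (Equiv.Perm (Fin n)) ι)

/-- The Fourier basis of `ℂ(S_n)`, normalised to be matrix units:
`Q^R_{ij} = (d(R)/n!) ∑_σ conj(D^R_{ij}(σ)) σ`. -/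
def fourier (R : ι) (i j : Fin (X.dim R)) : MonoidAlgebra ℂ (Equiv.Perm (Fin n)) :=
  ∑ s : Equiv.Perm (Fin n),
    ((X.dim R : ℂ) / (n.factorial : ℂ) * conj (X.entry R s i j)) • MonoidAlgebra.of ℂ _ s

/-- The elements of `𝒦_{Y₀}(n)` built from Clebsch-Gordan coefficients, for each block `b` and each
pair `(τ₁, τ₂)` of multiplicity indices. -/
def Q [LinearOrder ι] [Fintype κ] {Y : IrrepSystem (Equiv.Perm (Fin 3)) κ} (C : CGSystem X Y) :
    (b : Block ι κ) → Fin (blockSize X Y b) → Fin (blockSize X Y b) → Tri n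
  | .three R S T h, t₁, t₂ => ∑ i, ∑ j,
      ((C.three R S T h.1 h.2 t₁ : Arr X R S T) i *
        conj ((C.three R S T h.1 h.2 t₂ : Arr X R S T) j)) •
      ∑ a : Equiv.Perm (Fin 3), colour a
        (tri (fourier X R i.1 j.1) (fourier X S i.2.1 j.2.1) (fourier X T i.2.2 j.2.2))
  | .sym R S h, t₁, t₂ => ∑ i, ∑ j,
      ((C.sym R S h t₁ : Arr X R R S) i * conj ((C.sym R S h t₂ : Arr X R R S) j)) •
      (tri (fourier X R i.1 j.1) (fourier X R i.2.1 j.2.1) (fourier X S i.2.2 j.2.2) +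
       tri (fourier X R i.1 j.1) (fourier X S i.2.2 j.2.2) (fourier X R i.2.1 j.2.1) +
       tri (fourier X S i.2.2 j.2.2) (fourier X R i.1 j.1) (fourier X R i.2.1 j.2.1))
  | .alt R S h, t₁, t₂ => ∑ i, ∑ j,
      ((C.alt R S h t₁ : Arr X R R S) i * conj ((C.alt R S h t₂ : Arr X R R S) j)) •
      (tri (fourier X R i.1 j.1) (fourier X R i.2.1 j.2.1) (fourier X S i.2.2 j.2.2) +
       tri (fourier X R i.1 j.1) (fourier X S i.2.2 j.2.2) (fourier X R i.2.1 j.2.1) +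
       tri (fourier X S i.2.2 j.2.2) (fourier X R i.1 j.1) (fourier X R i.2.1 j.2.1))
  | .cube R L, t₁, t₂ => ∑ i, ∑ j, ∑ m,
      ((C.cube R ⟨L, t₁, m⟩ : Arr X R R R) i * conj ((C.cube R ⟨L, t₂, m⟩ : Arr X R R R) j)) •
      tri (fourier X R i.1 j.1) (fourier X R i.2.1 j.2.1) (fourier X R i.2.2 j.2.2)

end Basis

end ColourSym

end

/-! Fourier theory turns the statement into linear algebra. The elements `fourier X R i j` are
matrix units of ℂ(S_n), so ℂ(S_n)^{⊗3} is the direct sum of the algebras End(V_R ⊗ V_S ⊗ V_T) over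
ordered triples. Multiplying by diagonal elements on both sides acts on the source and target of
such an endomorphism. Hence 𝒦(n) is the direct sum of the algebras End(Inv(V_R ⊗ V_S ⊗ V_T)), where
Inv denotes the S_n-invariant vectors. It is spanned by the rank-one operators |c⟩⟨c'| with c, c'
invariant; these are the values of `couple`, and they multiply by `couple_mul`.

S₃ permutes the ordered triples. An invariant element is determined by its components on one triple
per orbit, and each of these must commute with the stabiliser of the triple. For three distinct
labels the stabiliser is trivial and all of End(Inv) survives. For (R,R,S) it is generated by the
flip, and its commutant is End of the symmetric part times End of the antisymmetric part. For
(R,R,R) it is S₃, and the commutant is a product over Λ of matrix algebras whose sizes are the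
multiplicities of V_Λ in Inv.

The proof implements this through the averaging operator `symmetrize`. Up to nonzero scalars the
elements `Q` are symmetrisations of couplings of Clebsch-Gordan vectors. Averaging arbitrary
couplings shows that they span (`mem_span_couple_of_mem_K`, `spannedBy`, `mem_spanQ`).
Orthonormality of the coefficients, together with Schur orthogonality for S_n and S₃, gives the
matrix unit relations (`Q_mul`, `Q_mul_of_ne`). As no diagonal unit vanishes (`Q_self_ne_zero`),
those relations give linear independence, and the Wedderburn isomorphism sends basis to basis.

Block sizes are defined as dimensions of Hom spaces such as Hom(V_T, V_R ⊗ V_S), whereas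
coefficients live in V_R ⊗ V_S ⊗ V_T. The dimensions agree because V_T is self-dual, each
permutation being conjugate to its inverse (`exists_conj_intertwiner`, `mult_eq_finrank`). For
(R,R,R), `finrank_equivariantFamilies` identifies the multiplicity with the dimension of a space of
S₃-equivariant families, and orthonormal bases of these spaces provide the coefficients. -/

noncomputable section

namespace ColourSym

/-! ### Schur's lemma and orthogonality of matrix entries -/

section IrrepSystem

variable {G ι : Type*} [Group G] (X : IrrepSystem G ι)

/-- The matrix `D^R(g)`. -/
abbrev IrrepSystem.mat (R : ι) (g : G) : Matrix (Fin (X.dim R)) (Fin (X.dim R)) ℂ := X.D R g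

lemma IrrepSystem.mat_mul (R : ι) (g h : G) : X.mat R (g * h) = X.mat R g * X.mat R h := by
  simp [IrrepSystem.mat]

lemma IrrepSystem.mat_one (R : ι) : X.mat R 1 = 1 := by
  simp [IrrepSystem.mat]

lemma IrrepSystem.entry_one (R : ι) (i j : Fin (X.dim R)) :
    X.entry R 1 i j = if i = j then 1 else 0 := by
  simp [IrrepSystem.entry, Matrix.one_apply]

lemma IrrepSystem.entry_mul (R : ι) (g h : G) (i j : Fin (X.dim R)) :
    X.entry R (g * h) i j = ∑ k, X.entry R g i k * X.entry R h k j := by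
  simp [IrrepSystem.entry, Matrix.mul_apply]

lemma IrrepSystem.entry_inv (R : ι) (g : G) (i j : Fin (X.dim R)) :
    X.entry R g⁻¹ i j = conj (X.entry R g j i) := by
  simp only [IrrepSystem.entry, map_inv]
  rfl

lemma IrrepSystem.rep_apply (R : ι) (g : G) (v : Fin (X.dim R) → ℂ) (i : Fin (X.dim R)) :
    X.rep R g v i = ∑ j, X.entry R g i j * v j := rfl

lemma IrrepSystem.dim_pos (R : ι) : 0 < X.dim R := by
  by_contra h
  have h0 : X.dim R = 0 := by omega
  have := X.irreducible R
  have hs : Subsingleton (Fin (X.dim R) → ℂ) := by rw [h0]; infer_instance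
  obtain ⟨a, b, hab⟩ := (this.toNontrivial).exists_pair_ne
  exact hab (SetLike.ext fun v => by
    rw [Subsingleton.elim v 0]
    exact ⟨fun _ => b.toSubmodule.zero_mem, fun _ => a.toSubmodule.zero_mem⟩)

/-- A matrix commuting with the matrices of two irreducible representations. -/
def intertwinerOfMatrix {R S : ι} (A : Matrix (Fin (X.dim R)) (Fin (X.dim S)) ℂ)
    (hA : ∀ g, X.mat R g * A = A * X.mat S g) :
    Representation.IntertwiningMap (X.rep S) (X.rep R) where
  toLinearMap := Matrix.toLin' A
  isIntertwining' g := by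
    change Matrix.toLin' A ∘ₗ Matrix.toLin' _ = Matrix.toLin' _ ∘ₗ Matrix.toLin' A
    rw [← Matrix.toLin'_mul, ← Matrix.toLin'_mul]
    exact congrArg _ (hA g).symm

lemma schur_ne {R S : ι} (h : R ≠ S) (A : Matrix (Fin (X.dim R)) (Fin (X.dim S)) ℂ)
    (hA : ∀ g, X.mat R g * A = A * X.mat S g) : A = 0 := by
  have := X.irreducible R
  have := X.irreducible S
  have : IsEmpty (Representation.Equiv (X.rep S) (X.rep R)) :=
    ⟨fun e => h (X.inequivalent S R ⟨e⟩).symm⟩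
  -- Schur's lemma enters as an instance: the intertwining maps between two inequivalent irreducible
  -- representations form a subsingleton.
  have h0 : intertwinerOfMatrix X A hA = 0 := Subsingleton.elim _ _
  have : Matrix.toLin' A = 0 := congrArg (·.toLinearMap) h0
  simpa using this

lemma schur_eq {R : ι} (A : Matrix (Fin (X.dim R)) (Fin (X.dim R)) ℂ)
    (hA : ∀ g, X.mat R g * A = A * X.mat R g) :
    ∃ c : ℂ, A = c • 1 := by
  have := X.irreducible R
  have h0 := (Representation.IsIrreducible.algebraMap_intertwiningMap_bijective_of_isAlgClosed
    (k := ℂ) (ρ := X.rep R)).2 (intertwinerOfMatrix X A hA)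
  obtain ⟨c, hc⟩ := h0
  refine ⟨c, ?_⟩
  have h1 : Matrix.toLin' A = c • LinearMap.id := by
    have := congrArg (·.toLinearMap) hc
    exact this.symm
  apply Matrix.toLin'.injective
  rw [h1, map_smul, Matrix.toLin'_one]

variable [Fintype G]

/-- The average `∑ g, D^R(g) E_{jl} D^S(g⁻¹)`. -/
def avgMatrix (R S : ι) (j : Fin (X.dim R)) (l : Fin (X.dim S)) :
    Matrix (Fin (X.dim R)) (Fin (X.dim S)) ℂ :=
  ∑ g, X.mat R g * Matrix.single j l (1 : ℂ) * X.mat S g⁻¹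

lemma avgMatrix_apply (R S : ι) (j : Fin (X.dim R)) (l : Fin (X.dim S)) (i k) :
    avgMatrix X R S j l i k = ∑ g, X.entry R g i j * conj (X.entry S g k l) := by
  simp only [avgMatrix, Matrix.sum_apply]
  refine Finset.sum_congr rfl fun g _ => ?_
  rw [← X.entry_inv, Matrix.mul_assoc, Matrix.mul_apply, Finset.sum_eq_single j]
  · simp [IrrepSystem.entry, IrrepSystem.mat]
  · intro b _ hb
    simp [hb]
  · simp

lemma avgMatrix_comm (R S : ι) (j : Fin (X.dim R)) (l : Fin (X.dim S)) (h : G) :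
    X.mat R h * avgMatrix X R S j l =
      avgMatrix X R S j l * X.mat S h := by
  simp only [avgMatrix, Matrix.mul_sum, Matrix.sum_mul]
  refine Fintype.sum_equiv (Equiv.mulLeft h) _ _ fun g => ?_
  have e1 : X.mat S g⁻¹ = X.mat S (h * g)⁻¹ * X.D S h := by
    rw [← X.mat_mul]; simp
  simp only [Equiv.coe_mulLeft, e1, X.mat_mul, Matrix.mul_assoc]

lemma entry_orthogonal_of_ne {R S : ι} (h : R ≠ S) (i j : Fin (X.dim R)) (k l : Fin (X.dim S)) :
    ∑ g, X.entry R g i j * conj (X.entry S g k l) = 0 := by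
  rw [← avgMatrix_apply, schur_ne X h _ (avgMatrix_comm X R S j l)]
  rfl

/-- By Schur the averaged matrix is a scalar, and its trace, which conjugation does not change,
determines that scalar. -/
lemma entry_orthogonal (R : ι) (i j k l : Fin (X.dim R)) :
    ∑ g, X.entry R g i j * conj (X.entry R g k l) =
      if i = k ∧ j = l then (Fintype.card G : ℂ) / X.dim R else 0 := by
  obtain ⟨c, hc⟩ := schur_eq X _ (avgMatrix_comm X R R j l)
  have htr : c * X.dim R = if j = l then (Fintype.card G : ℂ) else 0 := by
    have h1 : (avgMatrix X R R j l).trace = c * X.dim R := by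
      rw [hc, Matrix.trace_smul, Matrix.trace_one]; simp
    rw [← h1, avgMatrix, Matrix.trace_sum]
    have : ∀ g : G, (X.mat R g * Matrix.single j l (1 : ℂ) *
        X.mat R g⁻¹).trace = if j = l then 1 else 0 := by
      intro g
      rw [Matrix.trace_mul_comm, ← Matrix.mul_assoc, ← X.mat_mul]
      by_cases hjl : j = l
      · subst hjl; simp [X.mat_one]
      · simp [hjl, X.mat_one]
    simp only [this]
    split_ifs <;> simp
  have hd : (X.dim R : ℂ) ≠ 0 := by exact_mod_cast (X.dim_pos R).ne'
  have hc' : c = (if j = l then (Fintype.card G : ℂ) else 0) / X.dim R := by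
    rw [← htr]; field_simp
  rw [← avgMatrix_apply, hc, hc', Matrix.smul_apply, Matrix.one_apply]
  by_cases h1 : i = k <;> by_cases h2 : j = l <;> simp [h1, h2]

end IrrepSystem

/-! ### Completeness of matrix entries and self-duality -/

section Completeness

variable {G : Type*} [Group G]

/-- The representation of `G` on a left ideal of the group algebra, in coordinates. -/
def idealRep {m : ℕ} (N : Submodule (MonoidAlgebra ℂ G) (MonoidAlgebra ℂ G))
    (e : N ≃ₗ[ℂ] (Fin m → ℂ)) : Representation ℂ G (Fin m → ℂ) where
  toFun g := e.toLinearMap ∘ₗ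
    (Module.toModuleEnd ℂ N (MonoidAlgebra.of ℂ G g)) ∘ₗ e.symm.toLinearMap
  map_one' := by
    refine LinearMap.ext fun v => ?_
    simp [← MonoidAlgebra.one_def]
  map_mul' g h := by
    refine LinearMap.ext fun v => ?_
    simp [← mul_smul, MonoidAlgebra.single_mul_single]

lemma idealRep_apply {m : ℕ} (N : Submodule (MonoidAlgebra ℂ G) (MonoidAlgebra ℂ G))
    (e : N ≃ₗ[ℂ] (Fin m → ℂ)) (g : G) (v : N) :
    idealRep N e g (e v) = e (MonoidAlgebra.of ℂ G g • v) := by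
  simp [idealRep]

/-- The group elements span the group algebra, so a G-stable subspace is a submodule, and simplicity
of the ideal becomes irreducibility. -/
lemma idealRep_irreducible {m : ℕ} (N : Submodule (MonoidAlgebra ℂ G) (MonoidAlgebra ℂ G))
    [hN : IsSimpleModule (MonoidAlgebra ℂ G) N]
    (e : N ≃ₗ[ℂ] (Fin m → ℂ)) : (idealRep N e).IsIrreducible := by
  have key : ∀ σ : Subrepresentation (idealRep N e),
      ∃ P : Submodule (MonoidAlgebra ℂ G) N, ∀ v, v ∈ P ↔ e v ∈ σ := by
    intro σ
    refine ⟨{ carrier := {v | e v ∈ σ.toSubmodule}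
              add_mem' := fun {a b} ha hb => by
                simpa using σ.toSubmodule.add_mem ha hb
              zero_mem' := by simp
              smul_mem' := fun c v hv => ?_ }, fun v => Iff.rfl⟩
    simp only [Set.mem_ofPred_eq] at hv ⊢
    induction c using MonoidAlgebra.induction_on with
    | of g =>
      rw [← idealRep_apply]
      exact σ.apply_mem_toSubmodule g hv
    | add x y hx hy => rw [add_smul, map_add]; exact σ.toSubmodule.add_mem hx hy
    | smul r x hx => rw [smul_assoc, map_smul]; exact σ.toSubmodule.smul_mem r hx
  have hs := (isSimpleModule_iff _ _).1 hN
  refine { exists_pair_ne := ⟨⊥, ⊤, fun h => ?_⟩, eq_bot_or_eq_top := fun σ => ?_ }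
  · have := IsSimpleModule.nontrivial (MonoidAlgebra ℂ G) N
    obtain ⟨v, hv⟩ := exists_ne (0 : N)
    have : e v ∈ (⊥ : Subrepresentation (idealRep N e)) := by
      rw [h]; exact Submodule.mem_top
    exact hv (by simpa using (Submodule.mem_bot ℂ).1 this)
  · obtain ⟨P, hP⟩ := key σ
    rcases hs.eq_bot_or_eq_top P with h | h
    · left
      refine SetLike.ext fun w => ?_
      obtain ⟨v, rfl⟩ := e.surjective w
      rw [← hP, h, Submodule.mem_bot]
      exact (e.map_eq_zero_iff.symm).trans (Submodule.mem_bot ℂ).symm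
    · right
      refine SetLike.ext fun w => ?_
      obtain ⟨v, rfl⟩ := e.surjective w
      rw [← hP, h]
      exact ⟨fun _ => Submodule.mem_top, fun _ => Submodule.mem_top⟩

variable {ι : Type*} (X : IrrepSystem G ι) [Fintype G]

/-- Completeness of the list carries the operator ∑ x(g) ρ(g) to some V_R, where its matrix is the
Fourier transform of x. -/
lemma sum_smul_eq_zero_of_irreducible {x : G → ℂ}
    (hx : ∀ R i j, ∑ g, x g * X.entry R g i j = 0) {m : ℕ} (ρ : Representation ℂ G (Fin m → ℂ))
    (hρ : ρ.IsIrreducible) (v : Fin m → ℂ) : ∑ g, x g • ρ g v = 0 := by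
  obtain ⟨R, ⟨e⟩⟩ := X.complete m ρ hρ
  have h1 : e (∑ g, x g • ρ g v) = 0 := by
    rw [map_sum]
    have h2 : ∀ g, e (x g • ρ g v) = x g • X.rep R g (e v) := fun g => by
      rw [map_smul]
      exact congrArg _ (e.toIntertwiningMap.isIntertwining _ _ g v)
    simp only [h2]
    funext i
    simp only [Finset.sum_apply, Pi.smul_apply, X.rep_apply, smul_eq_mul, Finset.mul_sum,
      Pi.zero_apply]
    rw [Finset.sum_comm]
    refine Finset.sum_eq_zero fun j _ => ?_
    simp only [← mul_assoc]
    rw [← Finset.sum_mul, hx, zero_mul]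
  exact (EquivLike.injective e) (h1.trans (map_zero e).symm)

/-- A function on a finite group whose Fourier transform vanishes is zero. -/
lemma eq_zero_of_fourier_eq_zero {x : G → ℂ}
    (hx : ∀ R i j, ∑ g, x g * X.entry R g i j = 0) : x = 0 := by
  -- By Maschke the regular representation is a sum of simple left ideals, and x acts by zero on
  -- each. Acting on 1 then recovers x itself.
  have key : ∀ v : MonoidAlgebra ℂ G, ∑ g, x g • (MonoidAlgebra.of ℂ G g * v) = 0 := by
    intro v
    have hv : v ∈ sSup {N : Submodule (MonoidAlgebra ℂ G) (MonoidAlgebra ℂ G) |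
        IsSimpleModule (MonoidAlgebra ℂ G) N} := by
      rw [IsSemisimpleModule.sSup_simples_eq_top]; trivial
    rw [sSup_eq_iSup'] at hv
    refine Submodule.iSup_induction _ (motive := fun v =>
      ∑ g, x g • (MonoidAlgebra.of ℂ G g * v) = 0) hv ?_ (by simp) ?_
    · rintro ⟨N, hN⟩ v hv
      have hN' : IsSimpleModule (MonoidAlgebra ℂ G) N := hN
      let e := (Module.finBasis ℂ N).equivFun
      have h1 := sum_smul_eq_zero_of_irreducible X hx (idealRep N e) (idealRep_irreducible N e)
        (e ⟨v, hv⟩)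
      simp only [idealRep_apply, ← map_smul, ← map_sum] at h1
      have h2 := congrArg Subtype.val (e.map_eq_zero_iff.1 h1)
      simpa using h2
    · intro a b ha hb
      simp only [mul_add, smul_add, Finset.sum_add_distrib, ha, hb, add_zero]
  have h1 := key 1
  funext h
  have h2 := congrArg (fun y : MonoidAlgebra ℂ G => y.coeff h) h1
  classical
  simpa [MonoidAlgebra.coeff_sum, Finsupp.single_apply, mul_one] using h2

/-- The second orthogonality relation for matrix entries. -/
lemma entry_complete [Fintype ι] [DecidableEq G] (g h : G) :
    ∑ R, ∑ i, ∑ j, (X.dim R : ℂ) / Fintype.card G * (X.entry R g i j * conj (X.entry R h i j)) =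
      if g = h then 1 else 0 := by
  have hc : (Fintype.card G : ℂ) ≠ 0 := by exact_mod_cast Fintype.card_ne_zero
  -- For fixed g, the difference of the two sides is a function of h whose Fourier transform
  -- vanishes by the first orthogonality relation.
  have := eq_zero_of_fourier_eq_zero X (x := fun h =>
    (∑ R, ∑ i, ∑ j, (X.dim R : ℂ) / Fintype.card G *
      (X.entry R g i j * conj (X.entry R h i j))) - if g = h then 1 else 0) ?_
  · exact sub_eq_zero.1 (congrFun this h)
  intro S k l
  have hd : (X.dim S : ℂ) ≠ 0 := by exact_mod_cast (X.dim_pos S).ne'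
  have swap : ∑ h, (∑ R, ∑ i, ∑ j, (X.dim R : ℂ) / Fintype.card G *
      (X.entry R g i j * conj (X.entry R h i j))) * X.entry S h k l =
      ∑ R, ∑ i, ∑ j, (X.dim R : ℂ) / Fintype.card G * X.entry R g i j *
        ∑ h, X.entry S h k l * conj (X.entry R h i j) := by
    simp only [Finset.sum_mul, Finset.mul_sum]
    rw [Finset.sum_comm]
    refine Finset.sum_congr rfl fun R _ => ?_
    rw [Finset.sum_comm]
    refine Finset.sum_congr rfl fun i _ => ?_
    rw [Finset.sum_comm]
    exact Finset.sum_congr rfl fun j _ => Finset.sum_congr rfl fun h _ => by ring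
  simp only [sub_mul, Finset.sum_sub_distrib, swap, ite_mul, one_mul, zero_mul,
    Finset.sum_ite_eq, Finset.mem_univ, if_true]
  rw [Finset.sum_eq_single S]
  · simp only [entry_orthogonal, ite_and, mul_ite, mul_zero]
    have : ∀ i : Fin (X.dim S), (∑ j, if k = i then if l = j then
        (X.dim S : ℂ) / Fintype.card G * X.entry S g i j * (Fintype.card G / X.dim S) else 0
        else 0) = if k = i then X.entry S g k l else 0 := by
      intro i
      split_ifs with h
      · subst h
        simp only [Finset.sum_ite_eq, Finset.mem_univ, if_true]
        field_simp
      · simp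
    simp [this]
  · intro R _ hR
    simp [entry_orthogonal_of_ne X hR.symm]
  · simp

/-- If `g` and `g⁻¹` are always conjugate, every irreducible representation is equivalent to its
complex conjugate. -/
lemma exists_conj_intertwiner (hG : ∀ g : G, IsConj g g⁻¹) (R : ι) :
    ∃ M : (Matrix (Fin (X.dim R)) (Fin (X.dim R)) ℂ), IsUnit M ∧
      ∀ g i k, ∑ j, X.entry R g i j * M j k = ∑ j, M i j * conj (X.entry R g j k) := by
  have hchar : ∀ g, conj (X.mat R g).trace = (X.mat R g).trace := by
    intro g
    have h1 : (X.mat R g⁻¹).trace = conj (X.mat R g).trace := by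
      simp only [Matrix.trace, Matrix.diag_apply, map_sum]
      exact Finset.sum_congr rfl fun i _ => X.entry_inv R g i i
    obtain ⟨c, hc⟩ := isConj_iff.1 (hG g)
    rw [← h1, ← hc, X.mat_mul, Matrix.trace_mul_comm, ← X.mat_mul]
    simp
  -- The matrix `A j l` is ∑ D(g) E_{jl} D(g)ᵀ, an intertwiner from the conjugate representation to
  -- V_R. If all of these vanished, so would ∑ χ(g)², which is ∑ |χ(g)|² because χ is real; but χ(1)
  -- is the dimension, which is positive.
  let A (j l i k : Fin (X.dim R)) : ℂ := ∑ g, X.entry R g i j * X.entry R g k l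
  have hA : ∃ j l i k, A j l i k ≠ 0 := by
    by_contra! h
    have h1 : ∑ i, ∑ k, A i k i k = 0 := by simp [h]
    have h2 : ∑ i, ∑ k, A i k i k = ∑ g, ((Complex.normSq (X.mat R g).trace : ℝ) : ℂ) := by
      simp only [A]
      rw [Finset.sum_congr rfl fun i _ => Finset.sum_comm, Finset.sum_comm]
      refine Finset.sum_congr rfl fun g _ => ?_
      rw [Complex.normSq_eq_conj_mul_self, hchar, Matrix.trace, Finset.sum_mul_sum]
      rfl
    rw [h2, ← Complex.ofReal_sum, Complex.ofReal_eq_zero,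
      Finset.sum_eq_zero_iff_of_nonneg fun g _ => Complex.normSq_nonneg _] at h1
    have h3 := h1 1 (Finset.mem_univ _)
    rw [X.mat_one, Matrix.trace_one, Complex.normSq_eq_zero] at h3
    have := X.dim_pos R
    simp at h3
    omega
  obtain ⟨j, l, i₀, k₀, hne⟩ := hA
  let M : Matrix (Fin (X.dim R)) (Fin (X.dim R)) ℂ := Matrix.of (A j l)
  have hM : ∀ g i k, ∑ m, X.entry R g i m * M m k = ∑ m, M i m * conj (X.entry R g m k) := by
    intro h i k
    simp only [M, Matrix.of_apply, A, Finset.mul_sum, Finset.sum_mul]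
    rw [Finset.sum_comm, Finset.sum_comm (γ := Fin _)]
    refine Fintype.sum_equiv (Equiv.mulLeft h) _ _ fun g => ?_
    simp only [Equiv.coe_mulLeft, ← mul_assoc]
    rw [← Finset.sum_mul, ← X.entry_mul]
    simp only [mul_assoc]
    rw [← Finset.mul_sum]
    congr 1
    simp only [← X.entry_inv]
    rw [Finset.sum_congr rfl fun m _ => mul_comm _ _, ← X.entry_mul]
    simp
  -- The range of an intertwiner is stable; being nonzero in an irreducible representation, it is
  -- everything.
  let N : Subrepresentation (X.rep R) :=
    { toSubmodule := LinearMap.range (Matrix.toLin' M)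
      apply_mem_toSubmodule := by
        rintro g _ ⟨v, rfl⟩
        refine ⟨fun i => ∑ j, conj (X.entry R g i j) * v j, ?_⟩
        funext i
        simp only [X.rep_apply, Matrix.toLin'_apply, Matrix.mulVec, dotProduct, Finset.mul_sum,
          ← mul_assoc]
        rw [Finset.sum_comm]
        symm
        rw [Finset.sum_comm]
        exact Finset.sum_congr rfl fun m _ => by rw [← Finset.sum_mul, ← Finset.sum_mul, hM] }
  have hirr := X.irreducible R
  refine ⟨M, ?_, hM⟩
  rcases hirr.eq_bot_or_eq_top N with h | h
  · have h1 : LinearMap.range (Matrix.toLin' M) = ⊥ := congrArg (·.toSubmodule) h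
    rw [LinearMap.range_eq_bot, LinearEquiv.map_eq_zero_iff] at h1
    exact absurd (congrFun (congrFun h1 i₀) k₀) hne
  · have h1 : LinearMap.range (Matrix.toLin' M) = ⊤ := congrArg (·.toSubmodule) h
    rw [LinearMap.range_eq_top] at h1
    exact Matrix.mulVec_surjective_iff_isUnit.1 h1

end Completeness

/-! ### Multiplicities as dimensions of spaces of invariant arrays -/

section Multiplicities

variable {G ι : Type*} [Group G] (X : IrrepSystem G ι)

/-- Self-duality in coordinates: the columns of the conjugating intertwiner form a basis of V_R on
which G acts by the conjugate matrices. -/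
lemma exists_dual_basis [Fintype G] (hG : ∀ g : G, IsConj g g⁻¹) (R : ι) :
    ∃ b : Module.Basis (Fin (X.dim R)) ℂ (Fin (X.dim R) → ℂ),
      ∀ g k, X.rep R g (b k) = ∑ m, conj (X.entry R g m k) • b m := by
  obtain ⟨M, hM, h⟩ := exists_conj_intertwiner X hG R
  let e : (Fin (X.dim R) → ℂ) ≃ₗ[ℂ] (Fin (X.dim R) → ℂ) :=
    LinearEquiv.ofBijective (Matrix.toLin' M)
      ⟨Matrix.mulVec_injective_iff_isUnit.2 hM, Matrix.mulVec_surjective_iff_isUnit.2 hM⟩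
  have hb : ∀ k i, (Pi.basisFun ℂ (Fin (X.dim R))).map e k i = M i k := by
    intro k i
    change Matrix.toLin' M ((Pi.basisFun ℂ (Fin (X.dim R))) k) i = M i k
    simp
  refine ⟨(Pi.basisFun ℂ (Fin (X.dim R))).map e, fun g k => ?_⟩
  funext i
  simp only [X.rep_apply, hb, Finset.sum_apply, Pi.smul_apply, smul_eq_mul, h]
  exact Finset.sum_congr rfl fun m _ => mul_comm _ _

/-- The standard basis of `V_R ⊗ V_S`. -/
def tensorBasis (R S : ι) : Module.Basis (Fin (X.dim R) × Fin (X.dim S)) ℂ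
    ((Fin (X.dim R) → ℂ) ⊗[ℂ] (Fin (X.dim S) → ℂ)) :=
  (Pi.basisFun ℂ _).tensorProduct (Pi.basisFun ℂ _)

lemma tensorBasis_repr_tmul (R S : ι) (x : Fin (X.dim R) → ℂ) (y : Fin (X.dim S) → ℂ) (p) :
    (tensorBasis X R S).repr (x ⊗ₜ y) p = x p.1 * y p.2 := by
  obtain ⟨i, j⟩ := p
  rw [tensorBasis, Module.Basis.tensorProduct_repr_tmul_apply]
  simp [mul_comm]

lemma tensorBasis_repr_tprod (R S : ι) (g : G) (t) (p) :
    (tensorBasis X R S).repr ((X.rep R).tprod (X.rep S) g t) p =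
      ∑ q : Fin (X.dim R) × Fin (X.dim S), X.entry R g p.1 q.1 * X.entry S g p.2 q.2 *
        (tensorBasis X R S).repr t q := by
  induction t with
  | zero => simp
  | tmul x y =>
    simp only [Representation.tprod_apply, TensorProduct.map_tmul, tensorBasis_repr_tmul,
      X.rep_apply, Finset.sum_mul_sum, Fintype.sum_prod_type]
    exact Finset.sum_congr rfl fun i _ => Finset.sum_congr rfl fun j _ => by ring
  | add x y hx hy => simp only [map_add, Finsupp.add_apply, hx, hy, mul_add,
      Finset.sum_add_distrib]

lemma tensorBasis_repr_comm (R : ι) (t) (p : Fin (X.dim R) × Fin (X.dim R)) :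
    (tensorBasis X R R).repr (TensorProduct.comm ℂ _ _ t) p =
      (tensorBasis X R R).repr t (p.2, p.1) := by
  induction t with
  | zero => simp
  | tmul x y => simp only [TensorProduct.comm_tmul, tensorBasis_repr_tmul, mul_comm]
  | add x y hx hy => simp only [map_add, Finsupp.add_apply, hx, hy]

/-- The tensor in `V_R ⊗ V_S` obtained by fixing the last index of an array. -/
def slice {R S T : ι} (c : Arr X R S T) (k : Fin (X.dim T)) :
    (Fin (X.dim R) → ℂ) ⊗[ℂ] (Fin (X.dim S) → ℂ) :=
  (tensorBasis X R S).equivFun.symm fun p => c (p.1, p.2, k)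

lemma repr_slice {R S T : ι} (c : Arr X R S T) (k) (p) :
    (tensorBasis X R S).repr (slice X c k) p = c (p.1, p.2, k) := by
  have := congrFun ((tensorBasis X R S).equivFun.apply_symm_apply fun p => c (p.1, p.2, k)) p
  exact this

/-- Tensor-Hom adjunction: moving the third factor to the other side by unitarity says that the
slices transform as a basis of the dual of V_T. -/
lemma mem_inv3_iff {R S T : ι} (c : Arr X R S T) :
    c ∈ inv3 X R S T ↔ ∀ g k, (X.rep R).tprod (X.rep S) g (slice X c k) =
      ∑ m, conj (X.entry T g m k) • slice X c m := by
  have hsum : ∀ g (i : Fin (X.dim R) × Fin (X.dim S) × Fin (X.dim T)), (∑ j, X.entry R g i.1 j.1 * X.entry S g i.2.1 j.2.1 *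
      X.entry T g i.2.2 j.2.2 * c j) = ∑ k, X.entry T g i.2.2 k *
        (tensorBasis X R S).repr ((X.rep R).tprod (X.rep S) g (slice X c k)) (i.1, i.2.1) := by
    intro g i
    simp only [tensorBasis_repr_tprod, repr_slice, Finset.mul_sum]
    rw [Finset.sum_comm]
    simp only [Fintype.sum_prod_type]
    refine Finset.sum_congr rfl fun _ _ => Finset.sum_congr rfl fun _ _ =>
      Finset.sum_congr rfl fun _ _ => ?_
    ring
  constructor
  · intro h g k
    apply (tensorBasis X R S).repr.injective
    ext p
    simp only [map_sum, map_smul, Finsupp.coe_finsetSum, Finset.sum_apply, Finsupp.smul_apply,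
      smul_eq_mul, repr_slice]
    have h1 : ∀ m, c (p.1, p.2, m) = _ := fun m => ((h g (p.1, p.2, m)).symm.trans (hsum g _))
    simp only [h1, Finset.mul_sum, ← X.entry_inv, ← mul_assoc]
    rw [Finset.sum_comm]
    simp only [← Finset.sum_mul, ← X.entry_mul, inv_mul_cancel, X.entry_one, ite_mul, one_mul,
      zero_mul, Finset.sum_ite_eq, Finset.mem_univ, if_true]
  · intro h g i
    rw [hsum]
    simp only [h, map_sum, map_smul, Finsupp.coe_finsetSum, Finset.sum_apply, Finsupp.smul_apply,
      smul_eq_mul, repr_slice, Finset.mul_sum, ← X.entry_inv, ← mul_assoc]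
    rw [Finset.sum_comm]
    simp only [← Finset.sum_mul, ← X.entry_mul, mul_inv_cancel, X.entry_one, ite_mul, one_mul,
      zero_mul, Finset.sum_ite_eq, Finset.mem_univ, if_true]

/-- Subrepresentations of `V_R ⊗ V_S` (given through an injective intertwining map `j`):
intertwining maps from `V_T` correspond to invariant arrays whose slices lie in the range. -/
lemma mult_eq_finrank [Fintype G] (hG : ∀ g : G, IsConj g g⁻¹) (R S T : ι) {W : Type*}
    [AddCommMonoid W] [Module ℂ W] (σ : Representation ℂ G W)
    (j : W →ₗ[ℂ] (Fin (X.dim R) → ℂ) ⊗[ℂ] (Fin (X.dim S) → ℂ)) (hj : Function.Injective j)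
    (hjσ : ∀ g w, j (σ g w) = (X.rep R).tprod (X.rep S) g (j w))
    (P : Submodule ℂ (Arr X R S T))
    (hP : ∀ c, c ∈ P ↔ c ∈ inv3 X R S T ∧ ∀ k, slice X c k ∈ LinearMap.range j) :
    mult σ (X.rep T) = Module.finrank ℂ P := by
  obtain ⟨b, hb⟩ := exists_dual_basis X hG T
  -- An intertwiner f is recorded by the images f(b_k). Since b transforms by conjugate matrices,
  -- these images satisfy exactly the slice condition of `mem_inv3_iff`.
  let Φ : Representation.IntertwiningMap (X.rep T) σ →ₗ[ℂ] Arr X R S T :=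
    { toFun := fun f => WithLp.toLp 2 fun i =>
        (tensorBasis X R S).repr (j (f (b i.2.2))) (i.1, i.2.1)
      map_add' := fun f f' => by ext i; simp
      map_smul' := fun z f => by ext i; simp }
  have hΦ : ∀ f k, slice X (Φ f) k = j (f (b k)) := by
    intro f k
    apply (tensorBasis X R S).repr.injective
    ext p
    rw [repr_slice]
    rfl
  have hinj : Function.Injective Φ := by
    intro f f' h
    apply Representation.IntertwiningMap.ext
    refine b.ext fun k => hj ?_
    have := hΦ f k
    rw [h, hΦ] at this
    exact this.symm
  have hrange : LinearMap.range Φ = P := by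
    ext c
    rw [hP]
    constructor
    · rintro ⟨f, rfl⟩
      refine ⟨(mem_inv3_iff X _).2 fun g k => ?_, fun k => ⟨f (b k), (hΦ f k).symm⟩⟩
      simp only [hΦ, ← hjσ]
      rw [← f.isIntertwining, hb]
      simp
    · rintro ⟨h1, h2⟩
      rw [mem_inv3_iff] at h1
      choose w hw using h2
      have key : ∀ g v, b.constr ℂ w (X.rep T g v) = σ g (b.constr ℂ w v) := by
        intro g v
        have : b.constr ℂ w ∘ₗ X.rep T g = σ g ∘ₗ b.constr ℂ w := by
          refine b.ext fun k => hj ?_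
          simp only [LinearMap.comp_apply, hb, map_sum, map_smul, Module.Basis.constr_basis, hjσ,
            hw, h1]
        exact LinearMap.congr_fun this v
      refine ⟨(b.constr ℂ w).intertwiningMap_of_isIntertwiningMap _ _ key, ?_⟩
      ext i
      have h3 : j ((b.constr ℂ w).intertwiningMap_of_isIntertwiningMap _ _ key (b i.2.2)) =
          slice X c i.2.2 := by
        rw [LinearMap.toIntertwiningMap, Module.Basis.constr_basis, hw]
      change (tensorBasis X R S).repr (j _) (i.1, i.2.1) = c i
      rw [h3, repr_slice]
  rw [mult, ← hrange, LinearMap.finrank_range_of_inj hinj]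

lemma finrank_inv3 [Fintype G] (hG : ∀ g : G, IsConj g g⁻¹) (R S T : ι) :
    Module.finrank ℂ (inv3 X R S T) = kron X R S T :=
  (mult_eq_finrank X hG R S T _ LinearMap.id Function.injective_id (fun _ _ => rfl) _
    fun c => by simp).symm

lemma finrank_invSym [Fintype G] (hG : ∀ g : G, IsConj g g⁻¹) (R S : ι) :
    Module.finrank ℂ (invSym X R S) = multSym X R S := by
  refine (mult_eq_finrank X hG R R S (symSq (X.rep R)).toRepresentation
    (symSq (X.rep R)).toSubmodule.subtype Subtype.val_injective (fun _ _ => rfl) _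
    fun c => ?_).symm
  refine and_congr Iff.rfl ?_
  rw [Submodule.range_subtype]
  have h : ∀ k, slice X c k ∈ (symSq (X.rep R)).toSubmodule ↔
      ∀ p : Fin (X.dim R) × Fin (X.dim R), c (p.2, p.1, k) = c (p.1, p.2, k) := by
    intro k
    rw [symSq, LinearMap.mem_ker, LinearMap.sub_apply, sub_eq_zero,
      ← (tensorBasis X R R).repr.injective.eq_iff, Finsupp.ext_iff]
    refine forall_congr' fun p => ?_
    rw [LinearEquiv.coe_coe, tensorBasis_repr_comm, repr_slice, LinearMap.id_apply, repr_slice]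
  simp only [h, Prod.forall]
  exact ⟨fun h k i j => h i j k, fun h i j k => h k i j⟩

lemma finrank_invAlt [Fintype G] (hG : ∀ g : G, IsConj g g⁻¹) (R S : ι) :
    Module.finrank ℂ (invAlt X R S) = multAlt X R S := by
  refine (mult_eq_finrank X hG R R S (altSq (X.rep R)).toRepresentation
    (altSq (X.rep R)).toSubmodule.subtype Subtype.val_injective (fun _ _ => rfl) _
    fun c => ?_).symm
  refine and_congr Iff.rfl ?_
  rw [Submodule.range_subtype]
  have h : ∀ k, slice X c k ∈ (altSq (X.rep R)).toSubmodule ↔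
      ∀ p : Fin (X.dim R) × Fin (X.dim R), c (p.2, p.1, k) = -c (p.1, p.2, k) := by
    intro k
    rw [altSq, LinearMap.mem_ker, LinearMap.add_apply, add_eq_zero_iff_eq_neg,
      ← (tensorBasis X R R).repr.injective.eq_iff, Finsupp.ext_iff]
    refine forall_congr' fun p => ?_
    rw [LinearEquiv.coe_coe, tensorBasis_repr_comm, repr_slice, LinearMap.id_apply, map_neg,
      Finsupp.neg_apply, repr_slice]
  simp only [h, Prod.forall]
  exact ⟨fun h k i j => h i j k, fun h i j k => h k i j⟩

end Multiplicities

/-! ### The action of S₃ on V_R^{⊗3} -/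

section Cube

variable {G ι κ : Type*} [Group G] (X : IrrepSystem G ι)
  (Y : IrrepSystem (Equiv.Perm (Fin 3)) κ)

/-- The action of a permutation of the tensor factors on arrays `c_{i₁i₂i₃}`. -/
def permArr (R : ι) (a : Equiv.Perm (Fin 3)) : Arr X R R R →ₗ[ℂ] Arr X R R R where
  toFun c := WithLp.toLp 2 fun i => c (![i.1, i.2.1, i.2.2] (a 0), ![i.1, i.2.1, i.2.2] (a 1),
    ![i.1, i.2.1, i.2.2] (a 2))
  map_add' c d := by ext i; simp
  map_smul' z c := by ext i; simp

lemma vec3_eta {α : Type*} (i : Fin 3 → α) : ![i 0, i 1, i 2] = i := by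
  ext k; fin_cases k <;> rfl

lemma permArr_apply (R : ι) (a : Equiv.Perm (Fin 3)) (c : Arr X R R R)
    (i : Fin 3 → Fin (X.dim R)) :
    permArr X R a c (i 0, i 1, i 2) = c (i (a 0), i (a 1), i (a 2)) := by
  simp [permArr, vec3_eta]

/-- Triples as functions on `Fin 3`. -/
def tripleEquiv (α : Type*) : (Fin 3 → α) ≃ α × α × α where
  toFun i := (i 0, i 1, i 2)
  invFun p := ![p.1, p.2.1, p.2.2]
  left_inv i := vec3_eta i
  right_inv _ := rfl

lemma tripleEquiv_apply {α : Type*} (i : Fin 3 → α) : tripleEquiv α i = (i 0, i 1, i 2) := rfl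

lemma permArr_ext {R : ι} {c d : Arr X R R R}
    (h : ∀ i : Fin 3 → Fin (X.dim R), c (i 0, i 1, i 2) = d (i 0, i 1, i 2)) : c = d := by
  ext p
  exact h ![p.1, p.2.1, p.2.2]

/-- With the convention (a·c)(i) = c(i ∘ a) this is a left action, matching the action on tensors in
`tensorCube`. -/
lemma permArr_mul (R : ι) (a b : Equiv.Perm (Fin 3)) (c : Arr X R R R) :
    permArr X R (a * b) c = permArr X R a (permArr X R b c) := by
  refine permArr_ext X fun i => ?_
  have := permArr_apply X R b c (i ∘ a)
  rw [permArr_apply, permArr_apply]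
  exact this.symm

lemma permArr_one (R : ι) (c : Arr X R R R) : permArr X R 1 c = c :=
  permArr_ext X fun i => by rw [permArr_apply]; rfl

lemma inner_permArr (R : ι) (a : Equiv.Perm (Fin 3)) (c d : Arr X R R R) :
    inner ℂ (permArr X R a c) (permArr X R a d) = inner ℂ c d := by
  simp only [PiLp.inner_apply]
  rw [← (tripleEquiv (Fin (X.dim R))).sum_comp, ← (tripleEquiv (Fin (X.dim R))).sum_comp]
  refine Fintype.sum_equiv (a.symm.arrowCongr (Equiv.refl _)) _ _ fun i => ?_
  simp only [tripleEquiv_apply, permArr_apply]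
  rfl

lemma permArr_mem_inv3 (R : ι) (a : Equiv.Perm (Fin 3)) {c : Arr X R R R}
    (hc : c ∈ inv3 X R R R) : permArr X R a c ∈ inv3 X R R R := by
  intro g i
  have h : ∀ (d : Arr X R R R) (i : Fin 3 → Fin (X.dim R)),
      (∑ j : Fin (X.dim R) × Fin (X.dim R) × Fin (X.dim R),
        X.entry R g (i 0) j.1 * X.entry R g (i 1) j.2.1 * X.entry R g (i 2) j.2.2 * d j) =
      ∑ j : Fin 3 → Fin (X.dim R), (∏ k, X.entry R g (i k) (j k)) * d (j 0, j 1, j 2) := by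
    intro d i
    rw [← (tripleEquiv (Fin (X.dim R))).sum_comp]
    simp [tripleEquiv_apply, Fin.prod_univ_three]
  have h1 := h (permArr X R a c) ![i.1, i.2.1, i.2.2]
  simp only [Matrix.cons_val] at h1
  rw [h1]
  have h2 := permArr_apply X R a c ![i.1, i.2.1, i.2.2]
  simp only [Matrix.cons_val] at h2
  refine Eq.trans ?_ h2.symm
  rw [← hc g, h c (fun k => ![i.1, i.2.1, i.2.2] (a k))]
  refine Fintype.sum_equiv (a.symm.arrowCongr (Equiv.refl _)) _ _ fun j => ?_
  rw [permArr_apply]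
  congr 1
  rw [← Equiv.prod_comp a]
  rfl

/-- Families of invariant vectors in `V_R^{⊗3}` transforming under `S₃` with the matrices `D^Λ`. -/
def equivariantFamilies (R : ι) (L : κ) : Submodule ℂ (Fin (Y.dim L) → Arr X R R R) where
  carrier := {c | (∀ m, c m ∈ inv3 X R R R) ∧
    ∀ a m, permArr X R a (c m) = ∑ p, Y.entry L a p m • c p}
  add_mem' {c d} hc hd := ⟨fun m => add_mem (hc.1 m) (hd.1 m), fun a m => by
    simp only [Pi.add_apply, map_add, hc.2, hd.2, smul_add, Finset.sum_add_distrib]⟩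
  zero_mem' := ⟨fun m => zero_mem _, fun a m => by simp⟩
  smul_mem' z c hc := ⟨fun m => Submodule.smul_mem _ z (hc.1 m), fun a m => by
    simp only [Pi.smul_apply, map_smul, hc.2, Finset.smul_sum]
    exact Finset.sum_congr rfl fun p _ => smul_comm _ _ _⟩

/-- The standard basis of `V_R^{⊗3}`. -/
def cubeBasis (R : ι) : Module.Basis (Fin 3 → Fin (X.dim R)) ℂ
    (⨂[ℂ] _ : Fin 3, (Fin (X.dim R) → ℂ)) :=
  Basis.piTensorProduct fun _ => Pi.basisFun ℂ _

lemma cubeBasis_repr_tprod (R : ι) (v : Fin 3 → Fin (X.dim R) → ℂ) (p) :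
    (cubeBasis X R).repr (PiTensorProduct.tprod ℂ v) p = ∏ k, v k (p k) := by
  rw [cubeBasis, Basis.piTensorProduct_repr_tprod_apply]
  simp

lemma cubeBasis_repr_tensorCube (R : ι) (g : G) (a : Equiv.Perm (Fin 3)) (t) (p) :
    (cubeBasis X R).repr (tensorCube (X.rep R) (g, a) t) p =
      ∑ q : Fin 3 → Fin (X.dim R), (∏ k, X.entry R g (p k) (q k)) *
        (cubeBasis X R).repr t (q ∘ a) := by
  induction t using PiTensorProduct.induction_on with
  | smul_tprod r v =>
    have h1 : tensorCube (X.rep R) (g, a) (PiTensorProduct.tprod ℂ v) =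
        PiTensorProduct.tprod ℂ fun k => X.rep R g (v (a.symm k)) := by
      simp only [tensorCube, MonoidHom.coe_mk, OneHom.coe_mk, LinearMap.comp_apply,
        LinearEquiv.coe_coe, PiTensorProduct.reindex_tprod, PiTensorProduct.map_tprod]
    simp only [map_smul, h1, Finsupp.smul_apply, cubeBasis_repr_tprod, X.rep_apply, smul_eq_mul,
      Finset.prod_univ_sum, Fintype.piFinset_univ, Finset.mul_sum]
    refine Finset.sum_congr rfl fun q _ => ?_
    rw [Finset.prod_mul_distrib, ← Equiv.prod_comp a (fun k => v (a.symm k) (q k))]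
    simp only [Equiv.symm_apply_apply, Function.comp_apply]
    ring
  | add x y hx hy => simp only [map_add, Finsupp.add_apply, hx, hy, mul_add,
      Finset.sum_add_distrib]

/-- Coordinate arrays of elements of `V_R^{⊗3}`. -/
def cubeCoord (R : ι) : (⨂[ℂ] _ : Fin 3, (Fin (X.dim R) → ℂ)) ≃ₗ[ℂ] Arr X R R R :=
  (cubeBasis X R).equivFun ≪≫ₗ LinearEquiv.funCongrLeft ℂ ℂ (tripleEquiv _).symm ≪≫ₗ
    (WithLp.linearEquiv 2 ℂ _).symm

lemma cubeCoord_apply (R : ι) (t) (i : Fin 3 → Fin (X.dim R)) :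
    cubeCoord X R t (i 0, i 1, i 2) = (cubeBasis X R).repr t i := by
  change (cubeBasis X R).repr t ((tripleEquiv _).symm (tripleEquiv _ i)) = _
  rw [Equiv.symm_apply_apply]

lemma cubeCoord_perm (R : ι) (a : Equiv.Perm (Fin 3)) (t) :
    cubeCoord X R (tensorCube (X.rep R) (1, a) t) = permArr X R a (cubeCoord X R t) := by
  refine permArr_ext X fun i => ?_
  have h := cubeCoord_apply X R t (i ∘ a)
  rw [cubeCoord_apply, permArr_apply, cubeBasis_repr_tensorCube]
  refine Eq.trans ?_ h.symm
  simp only [X.entry_one]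
  rw [Finset.sum_eq_single i]
  · simp
  · intro q _ hq
    obtain ⟨k, hk⟩ := Function.ne_iff.1 hq
    rw [Finset.prod_eq_zero (Finset.mem_univ k) (if_neg hk.symm), zero_mul]
  · simp

lemma cubeCoord_mem_inv3 (R : ι) (t) : cubeCoord X R t ∈ inv3 X R R R ↔
    ∀ g, tensorCube (X.rep R) (g, 1) t = t := by
  have h : ∀ g, tensorCube (X.rep R) (g, 1) t = t ↔ ∀ i : Fin (X.dim R) × Fin (X.dim R) ×
      Fin (X.dim R), ∑ j, X.entry R g i.1 j.1 * X.entry R g i.2.1 j.2.1 *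
    X.entry R g i.2.2 j.2.2 * cubeCoord X R t j = cubeCoord X R t i := by
    intro g
    rw [← (cubeBasis X R).repr.injective.eq_iff, Finsupp.ext_iff,
      ← (tripleEquiv (Fin (X.dim R))).forall_congr_right]
    refine forall_congr' fun i => ?_
    rw [cubeBasis_repr_tensorCube, ← (tripleEquiv (Fin (X.dim R))).sum_comp]
    simp only [tripleEquiv_apply, cubeCoord_apply, Fin.prod_univ_three]
    rfl
  simp only [h]
  rfl

/-- An intertwiner out of V_{[n]} ⊗ V_Λ is determined by the images of the vectors 1 ⊗ e_m.
Equivariance under the first group makes these images invariant; equivariance under S₃ makes them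
transform by D^Λ. -/
lemma finrank_equivariantFamilies (R : ι) (L : κ) :
    Module.finrank ℂ (equivariantFamilies X Y R L) = multCube X Y R L := by
  let e (m : Fin (Y.dim L)) : Fin (Y.dim L) → ℂ := Pi.single m 1
  have he : ∀ a m, Y.rep L a (e m) = ∑ p, Y.entry L a p m • e p := by
    intro a m
    funext q
    simp [e, Pi.single_apply, Y.rep_apply]
  have hbox : ∀ g a v, trivialBox G (Y.rep L) (g, a) ((1 : ℂ) ⊗ₜ v) =
      (1 : ℂ) ⊗ₜ[ℂ] (Y.rep L a v) := fun g a v => rfl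
  let Φ : Representation.IntertwiningMap (trivialBox G (Y.rep L)) (tensorCube (X.rep R)) →ₗ[ℂ]
      (Fin (Y.dim L) → Arr X R R R) :=
    { toFun := fun f m => cubeCoord X R (f ((1 : ℂ) ⊗ₜ e m))
      map_add' := fun f f' => by funext m; simp
      map_smul' := fun z f => by funext m; simp }
  have hlin : ∀ {W : Type _} [AddCommGroup W] [Module ℂ W]
      (f f' : ℂ ⊗[ℂ] (Fin (Y.dim L) → ℂ) →ₗ[ℂ] W),
      (∀ m, f ((1 : ℂ) ⊗ₜ e m) = f' ((1 : ℂ) ⊗ₜ e m)) → f = f' := by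
    intro W _ _ f f' h
    refine TensorProduct.ext (LinearMap.ext_ring ?_)
    refine (Pi.basisFun ℂ _).ext fun m => ?_
    simpa using h m
  have hinj : Function.Injective Φ := by
    intro f f' h
    apply Representation.IntertwiningMap.ext
    exact hlin _ _ fun m => (cubeCoord X R).injective (congrFun h m)
  have hrange : LinearMap.range Φ = equivariantFamilies X Y R L := by
    ext c
    constructor
    · rintro ⟨f, rfl⟩
      refine ⟨fun m => ?_, fun a m => ?_⟩
      · change cubeCoord X R _ ∈ _
        rw [cubeCoord_mem_inv3]
        intro g
        rw [← f.isIntertwining, hbox]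
        simp
      · change permArr X R a (cubeCoord X R _) = ∑ p, _ • cubeCoord X R _
        rw [← cubeCoord_perm, ← f.isIntertwining, hbox, he, TensorProduct.tmul_sum]
        simp only [TensorProduct.tmul_smul, map_sum, map_smul]
    · rintro ⟨h1, h2⟩
      obtain ⟨f, hf⟩ : ∃ f : ℂ ⊗[ℂ] (Fin (Y.dim L) → ℂ) →ₗ[ℂ] (⨂[ℂ] _ : Fin 3,
          (Fin (X.dim R) → ℂ)), ∀ m, f ((1 : ℂ) ⊗ₜ e m) = (cubeCoord X R).symm (c m) := by
        refine ⟨(Pi.basisFun ℂ _).constr ℂ (fun m => (cubeCoord X R).symm (c m)) ∘ₗ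
          (TensorProduct.lid ℂ _).toLinearMap, fun m => ?_⟩
        have : e m = Pi.basisFun ℂ _ m := by simp [e]
        simp only [LinearMap.comp_apply, LinearEquiv.coe_coe, TensorProduct.lid_tmul, one_smul]
        rw [this, Module.Basis.constr_basis]
      have key : ∀ p v, f (trivialBox G (Y.rep L) p v) = tensorCube (X.rep R) p (f v) := by
        rintro ⟨g, a⟩ v
        have : f ∘ₗ trivialBox G (Y.rep L) (g, a) = tensorCube (X.rep R) (g, a) ∘ₗ f := by
          refine hlin _ _ fun m => ?_
          have hga : tensorCube (X.rep R) (g, a) =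
              tensorCube (X.rep R) (1, a) * tensorCube (X.rep R) (g, 1) := by
            rw [← map_mul]; simp
          rw [LinearMap.comp_apply, LinearMap.comp_apply, hbox, he, TensorProduct.tmul_sum, hf, hga,
            Module.End.mul_apply, map_sum]
          rw [(cubeCoord_mem_inv3 X R _).1 (by rw [LinearEquiv.apply_symm_apply]; exact h1 m)]
          apply (cubeCoord X R).injective
          rw [cubeCoord_perm, LinearEquiv.apply_symm_apply, h2]
          simp only [TensorProduct.tmul_smul, map_sum, map_smul, hf, LinearEquiv.apply_symm_apply]
        exact LinearMap.congr_fun this v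
      refine ⟨f.intertwiningMap_of_isIntertwiningMap _ _ key, ?_⟩
      funext m
      change cubeCoord X R (f _) = c m
      rw [hf, LinearEquiv.apply_symm_apply]
  rw [multCube, mult, ← hrange, LinearMap.finrank_range_of_inj hinj]

end Cube

/-! ### Existence of Clebsch-Gordan coefficients -/

section Existence

variable {G ι κ : Type*} [Group G] (X : IrrepSystem G ι)
  (Y : IrrepSystem (Equiv.Perm (Fin 3)) κ)

lemma card_perm_three : (Fintype.card (Equiv.Perm (Fin 3)) : ℂ) = 6 := by
  rw [Fintype.card_perm]; norm_num [Nat.factorial]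

/-- Permutations preserve the inner product, so it equals its average over S₃; the 6 is the order of
S₃. Schur orthogonality then applies to the inner sum over `a`. -/
lemma inner_families (R : ι) {L L' : κ} {c : Fin (Y.dim L) → Arr X R R R}
    {c' : Fin (Y.dim L') → Arr X R R R} (hc : c ∈ equivariantFamilies X Y R L)
    (hc' : c' ∈ equivariantFamilies X Y R L') (m : Fin (Y.dim L)) (m' : Fin (Y.dim L')) :
    6 * inner ℂ (c m) (c' m') = ∑ p, ∑ p', (∑ a, Y.entry L' a p' m' * conj (Y.entry L a p m)) *
      inner ℂ (c p) (c' p') := by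
  have h1 : ∀ a, inner ℂ (c m) (c' m') = ∑ p, ∑ p', Y.entry L' a p' m' *
      conj (Y.entry L a p m) * inner ℂ (c p) (c' p') := by
    intro a
    rw [← inner_permArr X R a, hc.2, hc'.2, sum_inner]
    simp only [inner_sum, inner_smul_left, inner_smul_right]
    exact Finset.sum_congr rfl fun p _ => Finset.sum_congr rfl fun p' _ => by ring
  have h2 : ∑ a : Equiv.Perm (Fin 3), inner ℂ (c m) (c' m') = 6 * inner ℂ (c m) (c' m') := by
    rw [Finset.sum_const, Finset.card_univ, nsmul_eq_mul, card_perm_three]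
  rw [← h2, Finset.sum_congr rfl fun a _ => h1 a, Finset.sum_comm]
  refine Finset.sum_congr rfl fun p _ => ?_
  rw [Finset.sum_comm]
  exact Finset.sum_congr rfl fun p' _ => (Finset.sum_mul _ _ _).symm

lemma inner_families_of_ne (R : ι) {L L' : κ} (h : L ≠ L') {c : Fin (Y.dim L) → Arr X R R R}
    {c' : Fin (Y.dim L') → Arr X R R R} (hc : c ∈ equivariantFamilies X Y R L)
    (hc' : c' ∈ equivariantFamilies X Y R L') (m : Fin (Y.dim L)) (m' : Fin (Y.dim L')) :
    inner ℂ (c m) (c' m') = 0 := by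
  have := inner_families X Y R hc hc' m m'
  simpa [entry_orthogonal_of_ne Y h.symm] using this

/-- A form of Schur's lemma: the Gram matrix of two families of the same type is scalar, so any
single component m₀ determines it. -/
lemma inner_families_eq (R : ι) {L : κ} {c c' : Fin (Y.dim L) → Arr X R R R}
    (hc : c ∈ equivariantFamilies X Y R L)
    (hc' : c' ∈ equivariantFamilies X Y R L) (m m' m₀ : Fin (Y.dim L)) :
    inner ℂ (c m) (c' m') = if m = m' then inner ℂ (c m₀) (c' m₀) else 0 := by
  have key : ∀ m m', 6 * inner ℂ (c m) (c' m') =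
      if m = m' then ∑ p, 6 / Y.dim L * inner ℂ (c p) (c' p) else 0 := by
    intro m m'
    rw [inner_families X Y R hc hc']
    simp only [entry_orthogonal, card_perm_three]
    by_cases h : m = m'
    · simp [h]
    · simp [h, Ne.symm h]
  have h6 : (6 : ℂ) ≠ 0 := by norm_num
  apply mul_left_cancel₀ h6
  rw [key, mul_ite, mul_zero, key m₀ m₀, if_pos rfl]

/-- Projections of an invariant vector to equivariant families. -/
lemma projection_mem_equivariantFamilies (R : ι) (L : κ) {x : Arr X R R R}
    (hx : x ∈ inv3 X R R R) (m : Fin (Y.dim L)) :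
    (fun p => ∑ a, conj (Y.entry L a p m) • permArr X R a x) ∈ equivariantFamilies X Y R L := by
  refine ⟨fun p => Submodule.sum_mem _ fun a _ =>
    Submodule.smul_mem _ _ (permArr_mem_inv3 X R a hx), fun b p => ?_⟩
  simp only [map_sum, map_smul, ← permArr_mul, Finset.smul_sum]
  rw [Finset.sum_comm]
  refine Fintype.sum_equiv (Equiv.mulLeft b) _ _ fun a => ?_
  simp only [smul_smul, ← Finset.sum_smul, Equiv.coe_mulLeft]
  congr 1
  have h : ∀ q, Y.entry L b q p = conj (Y.entry L b⁻¹ p q) := fun q => by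
    rw [Y.entry_inv, Complex.conj_conj]
  simp only [h, ← map_mul]
  rw [← map_sum, ← Y.entry_mul, inv_mul_cancel_left]

/-- The second orthogonality relation at the identity says that ∑_Λ (dim Λ / 6) conj χ_Λ is the
delta function at 1. Thus every invariant array is a sum of members of equivariant families. -/
lemma eq_sum_projections [Fintype κ] (R : ι) (x : Arr X R R R) :
    x = ∑ L, ∑ m : Fin (Y.dim L), ((Y.dim L : ℂ) / 6) •
      ∑ a, conj (Y.entry L a m m) • permArr X R a x := by
  have h1 : ∀ a, (∑ L, ∑ m : Fin (Y.dim L), (Y.dim L : ℂ) / 6 * conj (Y.entry L a m m)) =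
      if 1 = a then 1 else 0 := by
    intro a
    rw [← entry_complete Y 1 a]
    simp only [Y.entry_one, card_perm_three, ite_mul, one_mul, zero_mul, mul_ite, mul_zero,
      Finset.sum_ite_eq, Finset.mem_univ, if_true]
  have h2 : ∑ L, ∑ m : Fin (Y.dim L), ((Y.dim L : ℂ) / 6) •
      ∑ a, conj (Y.entry L a m m) • permArr X R a x =
      ∑ a, (∑ L, ∑ m : Fin (Y.dim L), (Y.dim L : ℂ) / 6 * conj (Y.entry L a m m)) •
        permArr X R a x := by
    simp only [Finset.smul_sum, Finset.sum_smul, smul_smul]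
    rw [Finset.sum_comm]
    refine Finset.sum_congr rfl fun L _ => ?_
    rw [Finset.sum_comm]
  rw [h2]
  simp only [h1, ite_smul, one_smul, zero_smul, Finset.sum_ite_eq, Finset.mem_univ, if_true,
    permArr_one]

/-- A basis of each space of equivariant families, orthonormal in every component. -/
lemma exists_orthonormal_families (R : ι) (L : κ) :
    ∃ b : Module.Basis (Fin (multCube X Y R L)) ℂ (equivariantFamilies X Y R L),
      ∀ t t' m m', inner ℂ ((b t).1 m) ((b t').1 m') = if t = t' ∧ m = m' then (1 : ℂ) else 0 := by
  obtain ⟨m₀⟩ : Nonempty (Fin (Y.dim L)) := ⟨⟨0, Y.dim_pos L⟩⟩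
  -- By `inner_families_eq`, evaluation at one index m₀ is injective and determines all inner
  -- products. An orthonormal basis of its image therefore pulls back to families orthonormal in
  -- every component.
  let ev : equivariantFamilies X Y R L →ₗ[ℂ] Arr X R R R :=
    (LinearMap.proj m₀).comp (equivariantFamilies X Y R L).subtype
  have hev : Function.Injective ev := by
    rw [← LinearMap.ker_eq_bot, LinearMap.ker_eq_bot']
    intro c hc
    ext1
    funext m
    have h0 : c.1 m₀ = 0 := hc
    have := inner_families_eq X Y R c.2 c.2 m m m₀
    rw [if_pos rfl, h0, inner_zero_left, inner_self_eq_zero] at this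
    exact this
  have hdim : Module.finrank ℂ (LinearMap.range ev) = multCube X Y R L := by
    rw [LinearMap.finrank_range_of_inj hev, finrank_equivariantFamilies]
  let o : OrthonormalBasis (Fin (multCube X Y R L)) ℂ (LinearMap.range ev) :=
    (stdOrthonormalBasis ℂ _).reindex (finCongr hdim)
  let b := o.toBasis.map (LinearEquiv.ofInjective ev hev).symm
  have hb : ∀ t, (b t).1 m₀ = o t := by
    intro t
    have h1 : (LinearEquiv.ofInjective ev hev (b t)) = o t := by
      simp [b]
    exact congrArg Subtype.val h1
  refine ⟨b, fun t t' m m' => ?_⟩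
  rw [inner_families_eq X Y R (b t).2 (b t').2 m m' m₀, hb, hb, ← Submodule.coe_inner,
    orthonormal_iff_ite.1 o.orthonormal]
  by_cases h1 : t = t' <;> by_cases h2 : m = m' <;> simp [h1, h2]

/-- For the first three kinds any orthonormal basis of the right size will do. Only the cubic kind
needs care: families of different Λ are orthogonal, and the projections show that together they
span. -/
lemma exists_CGSystem [LinearOrder ι] [Fintype κ] [Fintype G] (hG : ∀ g : G, IsConj g g⁻¹) :
    Nonempty (CGSystem X Y) := by
  classical
  choose b hb using exists_orthonormal_families X Y
  let v (R : ι) (x : Σ L : κ, Fin (multCube X Y R L) × Fin (Y.dim L)) : inv3 X R R R :=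
    ⟨(b R x.1 x.2.1).1 x.2.2, (b R x.1 x.2.1).2.1 x.2.2⟩
  have hv : ∀ R, Orthonormal ℂ (v R) := by
    intro R
    rw [orthonormal_iff_ite]
    rintro ⟨L, t, m⟩ ⟨L', t', m'⟩
    rw [Submodule.coe_inner]
    by_cases h : L = L'
    · subst h
      rw [hb]
      simp
    · rw [inner_families_of_ne X Y R h (b R L t).2 (b R L' t').2, if_neg]
      intro h'
      exact h (congrArg Sigma.fst h')
  have hspan : ∀ R, ⊤ ≤ Submodule.span ℂ (Set.range (v R)) := by
    rintro R ⟨x, hx⟩ -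
    have h1 : ∀ L, ∀ c ∈ equivariantFamilies X Y R L, ∀ m,
        c m ∈ (Submodule.span ℂ (Set.range (v R))).map (inv3 X R R R).subtype := by
      intro L c hc m
      have h2 := congrArg (fun c : equivariantFamilies X Y R L => c.1 m) ((b R L).sum_repr ⟨c, hc⟩)
      simp only [Submodule.coe_sum, Submodule.coe_smul, Finset.sum_apply, Pi.smul_apply] at h2
      rw [← h2]
      exact Submodule.sum_mem _ fun t _ => Submodule.smul_mem _ _
        ⟨v R ⟨L, t, m⟩, Submodule.subset_span ⟨_, rfl⟩, rfl⟩
    have h3 : x ∈ (Submodule.span ℂ (Set.range (v R))).map (inv3 X R R R).subtype := by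
      rw [eq_sum_projections X Y R x]
      exact Submodule.sum_mem _ fun L _ => Submodule.sum_mem _ fun m _ => Submodule.smul_mem _ _
        (h1 L _ (projection_mem_equivariantFamilies X Y R L hx m) m)
    obtain ⟨y, hy, hyx⟩ := h3
    have : y = ⟨x, hx⟩ := Subtype.ext hyx
    exact this ▸ hy
  refine ⟨{
    three := fun R S T _ _ => (stdOrthonormalBasis ℂ _).reindex (finCongr (finrank_inv3 X hG R S T))
    sym := fun R S _ => (stdOrthonormalBasis ℂ _).reindex (finCongr (finrank_invSym X hG R S))
    alt := fun R S _ => (stdOrthonormalBasis ℂ _).reindex (finCongr (finrank_invAlt X hG R S))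
    cube := fun R => OrthonormalBasis.mk (hv R) (hspan R)
    cube_equivariant := fun R L t m a i => ?_ }⟩
  simp only [OrthonormalBasis.coe_mk]
  have h := congrArg (fun c : Arr X R R R => c (i 0, i 1, i 2)) ((b R L t).2.2 a m)
  simp only [permArr_apply, WithLp.ofLp_sum, WithLp.ofLp_smul, Finset.sum_apply,
    Pi.smul_apply, smul_eq_mul] at h
  exact h

end Existence

/-! ### The triple tensor product as a group algebra -/

section Tri

variable {n : ℕ}

/-- The embedding of the group algebra in the `k`-th tensor slot. -/
def slot (k : Fin 3) : MonoidAlgebra ℂ (Equiv.Perm (Fin n)) →ₐ[ℂ] Tri n :=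
  MonoidAlgebra.mapDomainAlgHom ℂ ℂ (MonoidHom.mulSingle (fun _ : Fin 3 => Equiv.Perm (Fin n)) k)

lemma slot_of (k : Fin 3) (g : Equiv.Perm (Fin n)) :
    slot k (MonoidAlgebra.of ℂ _ g) =
      MonoidAlgebra.of ℂ (Fin 3 → Equiv.Perm (Fin n)) (Pi.mulSingle k g) := by
  simp [slot]

lemma slot_commute {k l : Fin 3} (h : k ≠ l) (a b : MonoidAlgebra ℂ (Equiv.Perm (Fin n))) :
    Commute (slot k a) (slot l b) := by
  induction a using MonoidAlgebra.induction_on with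
  | of g =>
    induction b using MonoidAlgebra.induction_on with
    | of g' =>
      rw [slot_of, slot_of]
      exact (Pi.mulSingle_commute (f := fun _ : Fin 3 => Equiv.Perm (Fin n)) h g g').map _
    | add x y hx hy => rw [map_add]; exact hx.add_right hy
    | smul r x hx => rw [map_smul]; exact hx.smul_right r
  | add x y hx hy => rw [map_add]; exact hx.add_left hy
  | smul r x hx => rw [map_smul]; exact hx.smul_left r

lemma tri_of (x y z : Equiv.Perm (Fin n)) :
    tri (MonoidAlgebra.of ℂ _ x) (MonoidAlgebra.of ℂ _ y) (MonoidAlgebra.of ℂ _ z) =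
      MonoidAlgebra.of ℂ (Fin 3 → Equiv.Perm (Fin n)) ![x, y, z] := by
  rw [tri, Finset.sum_eq_single ![x, y, z]]
  · simp
  · intro s _ hs
    have : ¬ (x = s 0 ∧ y = s 1 ∧ z = s 2) := by
      rintro ⟨rfl, rfl, rfl⟩
      exact hs (vec3_eta s).symm
    have h0 : (MonoidAlgebra.of ℂ _ x).coeff (s 0) * (MonoidAlgebra.of ℂ _ y).coeff (s 1) *
        (MonoidAlgebra.of ℂ _ z).coeff (s 2) = 0 := by
      simp only [MonoidAlgebra.of_apply, MonoidAlgebra.coeff_single, Finsupp.single_apply]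
      split_ifs <;> simp_all
    rw [h0, zero_smul]
  · simp

/-- Writing a pure tensor as a product of three commuting algebra embeddings makes trilinearity and
the slotwise product rule formal. -/
lemma tri_eq_slot (a b c : MonoidAlgebra ℂ (Equiv.Perm (Fin n))) :
    tri a b c = slot 0 a * slot 1 b * slot 2 c := by
  induction a using MonoidAlgebra.induction_on with
  | of x =>
    induction b using MonoidAlgebra.induction_on with
    | of y =>
      induction c using MonoidAlgebra.induction_on with
      | of z =>
        rw [tri_of, slot_of, slot_of, slot_of, ← map_mul, ← map_mul]
        congr 1
        ext k : 1
        fin_cases k <;> simp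
      | add c c' hc hc' =>
        rw [map_add, mul_add, ← hc, ← hc', tri, tri, tri, ← Finset.sum_add_distrib]
        exact Finset.sum_congr rfl fun s _ => by
          rw [← add_smul, MonoidAlgebra.coeff_add, Finsupp.add_apply, mul_add]
      | smul r c hc =>
        rw [map_smul, mul_smul_comm, ← hc, tri, tri, Finset.smul_sum]
        exact Finset.sum_congr rfl fun s _ => by
          rw [smul_smul, MonoidAlgebra.coeff_smul, Finsupp.smul_apply, smul_eq_mul]; congr 1; ring
    | add b b' hc hc' =>
      rw [map_add, mul_add, add_mul, ← hc, ← hc', tri, tri, tri, ← Finset.sum_add_distrib]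
      exact Finset.sum_congr rfl fun s _ => by
        rw [← add_smul, MonoidAlgebra.coeff_add, Finsupp.add_apply, mul_add, add_mul]
    | smul r b hc =>
      rw [map_smul, mul_smul_comm, smul_mul_assoc, ← hc, tri, tri, Finset.smul_sum]
      exact Finset.sum_congr rfl fun s _ => by
        rw [smul_smul, MonoidAlgebra.coeff_smul, Finsupp.smul_apply, smul_eq_mul]; congr 1; ring
  | add a a' hc hc' =>
    rw [map_add, add_mul, add_mul, ← hc, ← hc', tri, tri, tri, ← Finset.sum_add_distrib]
    exact Finset.sum_congr rfl fun s _ => by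
      rw [← add_smul, MonoidAlgebra.coeff_add, Finsupp.add_apply, add_mul, add_mul]
  | smul r a hc =>
    rw [map_smul, smul_mul_assoc, smul_mul_assoc, ← hc, tri, tri, Finset.smul_sum]
    exact Finset.sum_congr rfl fun s _ => by
      rw [smul_smul, MonoidAlgebra.coeff_smul, Finsupp.smul_apply, smul_eq_mul]; congr 1; ring

lemma tri_mul (a b c a' b' c' : MonoidAlgebra ℂ (Equiv.Perm (Fin n))) :
    tri a b c * tri a' b' c' = tri (a * a') (b * b') (c * c') := by
  simp only [tri_eq_slot, map_mul]
  have h1 := (slot_commute (n := n) (show (2 : Fin 3) ≠ 0 by decide) c a').eq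
  have h2 := (slot_commute (n := n) (show (2 : Fin 3) ≠ 1 by decide) c b').eq
  have h3 := (slot_commute (n := n) (show (1 : Fin 3) ≠ 0 by decide) b a').eq
  calc slot 0 a * slot 1 b * slot 2 c * (slot 0 a' * slot 1 b' * slot 2 c')
      = slot 0 a * slot 1 b * (slot 2 c * slot 0 a') * slot 1 b' * slot 2 c' := by
        simp only [mul_assoc]
    _ = slot 0 a * (slot 1 b * slot 0 a') * (slot 2 c * slot 1 b') * slot 2 c' := by
        rw [h1]; simp only [mul_assoc]
    _ = _ := by rw [h2, h3]; simp only [mul_assoc]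

lemma tri_ne_zero {a b c : MonoidAlgebra ℂ (Equiv.Perm (Fin n))} (ha : a.coeff 1 ≠ 0)
    (hb : b.coeff 1 ≠ 0) (hc : c.coeff 1 ≠ 0) : tri a b c ≠ 0 := by
  intro h
  have h1 := congrArg (fun y : Tri n => y.coeff 1) h
  simp [tri, MonoidAlgebra.coeff_sum, Finsupp.single_apply, ha, hb, hc] at h1

lemma diag_eq_tri (g : Equiv.Perm (Fin n)) :
    diag g = tri (MonoidAlgebra.of ℂ _ g) (MonoidAlgebra.of ℂ _ g) (MonoidAlgebra.of ℂ _ g) := by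
  rw [tri_of, diag]
  congr 1
  ext k : 1
  fin_cases k <;> rfl

lemma colour_of (a : Equiv.Perm (Fin 3)) (s : Fin 3 → Equiv.Perm (Fin n)) :
    colour a (MonoidAlgebra.of ℂ _ s) = MonoidAlgebra.of ℂ _ (s ∘ a.symm) := by
  simp [colour]
  rfl

lemma colour_tri (a : Equiv.Perm (Fin 3)) (x : Fin 3 → MonoidAlgebra ℂ (Equiv.Perm (Fin n))) :
    colour a (tri (x 0) (x 1) (x 2)) = tri (x (a.symm 0)) (x (a.symm 1)) (x (a.symm 2)) := by
  have h : ∀ x : Fin 3 → MonoidAlgebra ℂ (Equiv.Perm (Fin n)), tri (x 0) (x 1) (x 2) =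
      ∑ s : Fin 3 → Equiv.Perm (Fin n), (∏ k, (x k).coeff (s k)) • MonoidAlgebra.of ℂ _ s := by
    intro x
    simp only [tri, Fin.prod_univ_three]
  refine Eq.trans ?_ (h (x ∘ a.symm)).symm
  rw [h x, map_sum]
  simp only [map_smul, colour_of]
  refine Fintype.sum_equiv (a.arrowCongr (Equiv.refl _)) _ _ fun s => ?_
  congr 1
  rw [← Equiv.prod_comp a.symm]
  rfl

end Tri

/-! ### The Fourier basis as matrix units of ℂ(S_n) -/

section Fourier

variable {n : ℕ} {ι : Type*} (X : IrrepSystem (Equiv.Perm (Fin n)) ι)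

lemma coeff_fourier (R : ι) (i j : Fin (X.dim R)) (s : Equiv.Perm (Fin n)) :
    (fourier X R i j).coeff s = (X.dim R : ℂ) / (n.factorial : ℂ) * conj (X.entry R s i j) := by
  simp [fourier, MonoidAlgebra.coeff_sum, Finsupp.single_apply]

lemma card_perm_cast : (Fintype.card (Equiv.Perm (Fin n)) : ℂ) = n.factorial := by
  rw [Fintype.card_perm, Fintype.card_fin]

lemma coeff_fourier_ne_zero (R : ι) (i : Fin (X.dim R)) : (fourier X R i i).coeff 1 ≠ 0 := by
  rw [coeff_fourier, X.entry_one, if_pos rfl, map_one, mul_one]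
  exact div_ne_zero (by exact_mod_cast (X.dim_pos R).ne') (by exact_mod_cast n.factorial_ne_zero)

lemma of_mul_fourier (g : Equiv.Perm (Fin n)) (R : ι) (i j : Fin (X.dim R)) :
    MonoidAlgebra.of ℂ _ g * fourier X R i j = ∑ m, X.entry R g m i • fourier X R m j := by
  apply MonoidAlgebra.ext
  ext s
  rw [MonoidAlgebra.of_apply, MonoidAlgebra.coeff_single_mul_apply, one_mul, coeff_fourier,
    X.entry_mul, map_sum, MonoidAlgebra.coeff_sum, Finsupp.coe_finsetSum, Finset.sum_apply,
    Finset.mul_sum]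
  refine Finset.sum_congr rfl fun m _ => ?_
  rw [MonoidAlgebra.coeff_smul, Finsupp.smul_apply, coeff_fourier, smul_eq_mul, map_mul,
    X.entry_inv, Complex.conj_conj]
  ring

lemma fourier_mul_of (g : Equiv.Perm (Fin n)) (R : ι) (i j : Fin (X.dim R)) :
    fourier X R i j * MonoidAlgebra.of ℂ _ g = ∑ m, X.entry R g j m • fourier X R i m := by
  apply MonoidAlgebra.ext
  ext s
  rw [MonoidAlgebra.of_apply, MonoidAlgebra.coeff_mul_single_apply, mul_one, coeff_fourier,
    X.entry_mul, map_sum, MonoidAlgebra.coeff_sum, Finsupp.coe_finsetSum, Finset.sum_apply,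
    Finset.mul_sum]
  refine Finset.sum_congr rfl fun m _ => ?_
  rw [MonoidAlgebra.coeff_smul, Finsupp.smul_apply, coeff_fourier, smul_eq_mul, map_mul,
    X.entry_inv, Complex.conj_conj]
  ring

lemma fourier_mul_eq_sum (R S : ι) (i j : Fin (X.dim R)) (k l : Fin (X.dim S)) :
    fourier X R i j * fourier X S k l = ∑ m, ((X.dim R : ℂ) / (n.factorial : ℂ) *
      ∑ s, X.entry S s m k * conj (X.entry R s i j)) • fourier X S m l := by
  rw [fourier, Finset.sum_mul]
  simp only [smul_mul_assoc, of_mul_fourier, Finset.smul_sum, Finset.mul_sum, Finset.sum_smul]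
  rw [Finset.sum_comm]
  refine Finset.sum_congr rfl fun m _ => Finset.sum_congr rfl fun s _ => ?_
  rw [smul_smul]
  congr 1
  ring

lemma fourier_mul_of_ne {R S : ι} (h : R ≠ S) (i j : Fin (X.dim R)) (k l : Fin (X.dim S)) :
    fourier X R i j * fourier X S k l = 0 := by
  rw [fourier_mul_eq_sum]
  simp [entry_orthogonal_of_ne X h.symm]

/-- The normalisation d(R)/n! cancels the factor n!/d(R) produced by Schur orthogonality. -/
lemma fourier_mul (R : ι) (i j k l : Fin (X.dim R)) :
    fourier X R i j * fourier X R k l = if j = k then fourier X R i l else 0 := by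
  have hd : (X.dim R : ℂ) ≠ 0 := by exact_mod_cast (X.dim_pos R).ne'
  have hn : (n.factorial : ℂ) ≠ 0 := by exact_mod_cast n.factorial_ne_zero
  rw [fourier_mul_eq_sum]
  simp only [entry_orthogonal, card_perm_cast]
  rw [Finset.sum_eq_single i]
  · by_cases h : j = k
    · rw [if_pos ⟨rfl, h.symm⟩, if_pos h]
      have : (X.dim R : ℂ) / n.factorial * (n.factorial / X.dim R) = 1 := by field_simp
      rw [this, one_smul]
    · rw [if_neg (fun h' => h h'.2.symm), if_neg h, mul_zero, zero_smul]
  · intro m _ hm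
    rw [if_neg (fun h' => hm h'.1), mul_zero, zero_smul]
  · simp

/-- Fourier inversion, a restatement of the second orthogonality relation; it makes the Fourier
elements span. -/
lemma of_eq_sum_fourier [Fintype ι] (g : Equiv.Perm (Fin n)) :
    MonoidAlgebra.of ℂ _ g = ∑ R, ∑ i, ∑ j, X.entry R g i j • fourier X R i j := by
  apply MonoidAlgebra.ext
  ext s
  rw [MonoidAlgebra.of_apply, MonoidAlgebra.coeff_single, Finsupp.single_apply, ← entry_complete X]
  simp only [MonoidAlgebra.coeff_sum, Finsupp.coe_finsetSum, Finset.sum_apply,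
    MonoidAlgebra.coeff_smul, Finsupp.smul_apply, coeff_fourier, smul_eq_mul, card_perm_cast]
  exact Finset.sum_congr rfl fun R _ => Finset.sum_congr rfl fun i _ =>
    Finset.sum_congr rfl fun j _ => by ring

/-- The property of symmetric groups that makes all their irreducible representations self-dual. -/
lemma isConj_inv (g : Equiv.Perm (Fin n)) : IsConj g g⁻¹ := by
  rw [Equiv.Perm.isConj_iff_cycleType_eq, Equiv.Perm.cycleType_inv]

end Fourier

/-! ### Couplings as rank-one operators, and the span of 𝒦(n) -/

section Couple

variable {n : ℕ} {ι : Type*} (X : IrrepSystem (Equiv.Perm (Fin n)) ι)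

/-- The Fourier basis `Q^R_{i₁j₁} ⊗ Q^S_{i₂j₂} ⊗ Q^T_{i₃j₃}` of `ℂ(S_n)^{⊗3}`. -/
def fourier3 (R S T : ι) (i j : Fin (X.dim R) × Fin (X.dim S) × Fin (X.dim T)) : Tri n :=
  tri (fourier X R i.1 j.1) (fourier X S i.2.1 j.2.1) (fourier X T i.2.2 j.2.2)

/-- The element `∑_{i,j} c_i conj(c'_j) Q_{i₁j₁} ⊗ Q_{i₂j₂} ⊗ Q_{i₃j₃}`, as a sesquilinear map. -/
def couple (R S T : ι) : Arr X R S T →ₗ[ℂ] Arr X R S T →ₛₗ[starRingEnd ℂ] Tri n :=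
  LinearMap.mk₂'ₛₗ (RingHom.id ℂ) (starRingEnd ℂ)
    (fun c c' => ∑ i, ∑ j, (c i * conj (c' j)) • fourier3 X R S T i j)
    (fun c d c' => by simp only [PiLp.add_apply, add_mul, add_smul, Finset.sum_add_distrib])
    (fun z c c' => by
      simp only [PiLp.smul_apply, smul_eq_mul, mul_assoc, mul_smul, Finset.smul_sum,
        RingHom.id_apply])
    (fun c c' d' => by
      simp only [PiLp.add_apply, map_add, mul_add, add_smul, Finset.sum_add_distrib])
    (fun z c c' => by
      simp only [PiLp.smul_apply, smul_eq_mul, map_mul, Finset.smul_sum, smul_smul]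
      exact Finset.sum_congr rfl fun i _ => Finset.sum_congr rfl fun j _ => by congr 1; ring)

variable {R S T : ι}

lemma couple_apply (c c' : Arr X R S T) :
    couple X R S T c c' = ∑ i, ∑ j, (c i * conj (c' j)) • fourier3 X R S T i j := rfl

lemma couple_single (i j : Fin (X.dim R) × Fin (X.dim S) × Fin (X.dim T)) :
    couple X R S T (EuclideanSpace.single i 1) (EuclideanSpace.single j 1) =
      fourier3 X R S T i j := by
  rw [couple_apply, Finset.sum_eq_single i, Finset.sum_eq_single j]
  · simp
  · intro b _ hb; simp [hb]
  · simp
  · intro b _ hb; simp [hb]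
  · simp

lemma fourier3_mul (i j k l : Fin (X.dim R) × Fin (X.dim S) × Fin (X.dim T)) :
    fourier3 X R S T i j * fourier3 X R S T k l = if j = k then fourier3 X R S T i l else 0 := by
  obtain ⟨j1, j2, j3⟩ := j
  obtain ⟨k1, k2, k3⟩ := k
  simp only [fourier3, tri_mul, fourier_mul, Prod.mk.injEq]
  by_cases h1 : j1 = k1
  · by_cases h2 : j2 = k2
    · by_cases h3 : j3 = k3
      · simp [h1, h2, h3]
      · simp [h3, tri_eq_slot]
    · simp [h2, tri_eq_slot]
  · simp [h1, tri_eq_slot]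

/-- The composition rule |c⟩⟨c'| · |e⟩⟨e'| = ⟨c', e⟩ |c⟩⟨e'| for rank-one operators. -/
lemma couple_mul (c c' e e' : Arr X R S T) :
    couple X R S T c c' * couple X R S T e e' = inner ℂ c' e • couple X R S T c e' := by
  simp only [couple_apply, Finset.sum_mul]
  rw [Finset.smul_sum]
  refine Finset.sum_congr rfl fun i _ => ?_
  have h : ∀ j, ((c i * conj (c' j)) • fourier3 X R S T i j) *
      ∑ k, ∑ l, (e k * conj (e' l)) • fourier3 X R S T k l =
      ∑ l, (conj (c' j) * e j) • (c i * conj (e' l)) • fourier3 X R S T i l := by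
    intro j
    simp only [Finset.mul_sum, smul_mul_smul_comm, fourier3_mul, smul_ite, smul_zero]
    rw [Finset.sum_comm]
    simp only [Finset.sum_ite_eq, Finset.mem_univ, if_true]
    refine Finset.sum_congr rfl fun l _ => ?_
    rw [smul_smul]
    congr 1
    ring
  simp only [h]
  rw [Finset.sum_comm, Finset.smul_sum]
  refine Finset.sum_congr rfl fun l _ => ?_
  rw [← Finset.sum_smul]
  congr 1
  simp only [PiLp.inner_apply, RCLike.inner_apply]
  exact Finset.sum_congr rfl fun j _ => mul_comm _ _

/-- Multiplying by |d⟩⟨c| on the left and |c⟩⟨d| on the right, with d a standard basis vector, gives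
a diagonal Fourier element, whose coefficient at the identity is nonzero. -/
lemma couple_self_ne_zero {c : Arr X R S T} (hc : inner ℂ c c = (1 : ℂ)) :
    couple X R S T c c ≠ 0 := by
  intro h
  let i : Fin (X.dim R) × Fin (X.dim S) × Fin (X.dim T) :=
    (⟨0, X.dim_pos R⟩, ⟨0, X.dim_pos S⟩, ⟨0, X.dim_pos T⟩)
  let d : Arr X R S T := EuclideanSpace.single i 1
  have h1 : couple X R S T d c * couple X R S T c c * couple X R S T c d =
      fourier3 X R S T i i := by
    rw [couple_mul, hc, one_smul, couple_mul, hc, one_smul, couple_single]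
  rw [h, mul_zero, zero_mul] at h1
  exact tri_ne_zero (coeff_fourier_ne_zero X R _) (coeff_fourier_ne_zero X S _)
    (coeff_fourier_ne_zero X T _) h1.symm

lemma tri_sum_smul {α β γ : Type*} [Fintype α] [Fintype β] [Fintype γ] (u : α → ℂ) (v : β → ℂ)
    (w : γ → ℂ) (f : α → MonoidAlgebra ℂ (Equiv.Perm (Fin n)))
    (g : β → MonoidAlgebra ℂ (Equiv.Perm (Fin n))) (h : γ → MonoidAlgebra ℂ (Equiv.Perm (Fin n))) :
    tri (∑ x, u x • f x) (∑ y, v y • g y) (∑ z, w z • h z) =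
      ∑ p : α × β × γ, (u p.1 * v p.2.1 * w p.2.2) • tri (f p.1) (g p.2.1) (h p.2.2) := by
  simp only [tri_eq_slot, map_sum, map_smul, Fintype.sum_prod_type]
  rw [Finset.sum_mul, Finset.sum_mul]
  refine Finset.sum_congr rfl fun x _ => ?_
  simp only [Finset.mul_sum, Finset.sum_mul]
  rw [Finset.sum_comm]
  exact Finset.sum_congr rfl fun y _ => Finset.sum_congr rfl fun z _ => by
    rw [smul_mul_smul_comm, smul_mul_smul_comm]

/-- The diagonal action of the group on arrays. -/
def actArr (R S T : ι) (g : Equiv.Perm (Fin n)) : Arr X R S T →ₗ[ℂ] Arr X R S T where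
  toFun c := WithLp.toLp 2 fun i => ∑ j, X.entry R g i.1 j.1 * X.entry S g i.2.1 j.2.1 *
    X.entry T g i.2.2 j.2.2 * c j
  map_add' c d := by ext i; simp [mul_add, Finset.sum_add_distrib]
  map_smul' z c := by
    ext i
    simp only [PiLp.smul_apply, smul_eq_mul, RingHom.id_apply, Finset.mul_sum]
    exact Finset.sum_congr rfl fun j _ => by ring

lemma actArr_apply (g : Equiv.Perm (Fin n)) (c : Arr X R S T) (i) :
    actArr X R S T g c i = ∑ j, X.entry R g i.1 j.1 * X.entry S g i.2.1 j.2.1 *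
      X.entry T g i.2.2 j.2.2 * c j := rfl

lemma mem_inv3_iff_actArr (c : Arr X R S T) :
    c ∈ inv3 X R S T ↔ ∀ g, actArr X R S T g c = c :=
  forall_congr' fun _ => ⟨fun h => PiLp.ext h, fun h i => congrArg (fun d : Arr X R S T => d i) h⟩

lemma actArr_mul (g h : Equiv.Perm (Fin n)) (c : Arr X R S T) :
    actArr X R S T (g * h) c = actArr X R S T g (actArr X R S T h c) := by
  ext i
  simp only [actArr_apply, Finset.mul_sum]
  rw [Finset.sum_comm]
  refine Finset.sum_congr rfl fun j _ => ?_
  simp only [X.entry_mul, Fintype.sum_prod_type]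
  rw [Finset.sum_mul, Finset.sum_mul, Finset.sum_mul]
  refine Finset.sum_congr rfl fun x _ => ?_
  simp only [Finset.mul_sum, Finset.sum_mul]
  rw [Finset.sum_comm]
  exact Finset.sum_congr rfl fun y _ => Finset.sum_congr rfl fun z _ => by ring

lemma diag_mul_couple (g : Equiv.Perm (Fin n)) (c c' : Arr X R S T) :
    diag g * couple X R S T c c' = couple X R S T (actArr X R S T g c) c' := by
  have h : ∀ i j, diag g * fourier3 X R S T i j = ∑ m, (X.entry R g m.1 i.1 *
      X.entry S g m.2.1 i.2.1 * X.entry T g m.2.2 i.2.2) • fourier3 X R S T m j := by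
    intro i j
    rw [diag_eq_tri, fourier3, tri_mul, of_mul_fourier, of_mul_fourier, of_mul_fourier,
      tri_sum_smul]
    rfl
  simp only [couple_apply, Finset.mul_sum, mul_smul_comm, h, Finset.smul_sum, actArr_apply,
    Finset.sum_mul, Finset.sum_smul, smul_smul]
  rw [Finset.sum_comm]
  rw [Finset.sum_congr rfl fun j _ => Finset.sum_comm, Finset.sum_comm]
  refine Finset.sum_congr rfl fun m _ => Finset.sum_congr rfl fun j _ =>
    Finset.sum_congr rfl fun i _ => ?_
  congr 1
  ring

/-- The second argument enters conjugated, so by unitarity right multiplication by g acts on it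
through g⁻¹. -/
lemma couple_mul_diag (g : Equiv.Perm (Fin n)) (c c' : Arr X R S T) :
    couple X R S T c c' * diag g = couple X R S T c (actArr X R S T g⁻¹ c') := by
  have h : ∀ i j, fourier3 X R S T i j * diag g = ∑ m, (X.entry R g j.1 m.1 *
      X.entry S g j.2.1 m.2.1 * X.entry T g j.2.2 m.2.2) • fourier3 X R S T i m := by
    intro i j
    rw [diag_eq_tri, fourier3, tri_mul, fourier_mul_of, fourier_mul_of, fourier_mul_of,
      tri_sum_smul]
    rfl
  simp only [couple_apply, Finset.sum_mul, smul_mul_assoc, h, Finset.smul_sum, actArr_apply,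
    map_sum, map_mul, Finset.mul_sum, Finset.sum_smul, smul_smul, X.entry_inv, Complex.conj_conj]
  refine Finset.sum_congr rfl fun i _ => ?_
  rw [Finset.sum_comm]
  refine Finset.sum_congr rfl fun m _ => Finset.sum_congr rfl fun j _ => ?_
  congr 1
  ring

lemma couple_mem_K {c c' : Arr X R S T} (hc : c ∈ inv3 X R S T) (hc' : c' ∈ inv3 X R S T) :
    couple X R S T c c' ∈ K n := by
  rw [mem_inv3_iff_actArr] at hc hc'
  exact ⟨fun g => by rw [diag_mul_couple, hc], fun g => by rw [couple_mul_diag, hc']⟩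

/-- The sum of an array over the group, a multiple of its projection to the invariants. -/
lemma sum_actArr_mem_inv3 (c : Arr X R S T) : ∑ g, actArr X R S T g c ∈ inv3 X R S T := by
  rw [mem_inv3_iff_actArr]
  intro g
  simp only [map_sum, ← actArr_mul]
  exact Fintype.sum_equiv (Equiv.mulLeft g) _ _ fun h => rfl

lemma span_fourier3 [Fintype ι] (x : Tri n) :
    x ∈ Submodule.span ℂ {y | ∃ R S T i j, y = fourier3 X R S T i j} := by
  induction x using MonoidAlgebra.induction_on with
  | of s =>
    rw [← vec3_eta s, ← tri_of]
    simp only [of_eq_sum_fourier X, tri_eq_slot, map_sum, map_smul, Finset.sum_mul,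
      Finset.mul_sum, smul_mul_assoc, mul_smul_comm]
    iterate 3
      refine Submodule.sum_mem _ fun _ _ => Submodule.sum_mem _ fun _ _ =>
        Submodule.sum_mem _ fun _ _ => Submodule.smul_mem _ _ ?_
    rw [← tri_eq_slot]
    exact Submodule.subset_span ⟨_, _, _, (_, _, _), (_, _, _), rfl⟩
  | add x y hx hy => exact add_mem hx hy
  | smul r x hx => exact Submodule.smul_mem _ _ hx

/-- `𝒦(n)` is spanned by pairs of invariant arrays. -/
lemma mem_span_couple_of_mem_K [Fintype ι] {x : Tri n} (hx : x ∈ K n) :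
    x ∈ Submodule.span ℂ {y | ∃ R S T, ∃ c ∈ inv3 X R S T, ∃ c' ∈ inv3 X R S T,
      y = couple X R S T c c'} := by
  set W := Submodule.span ℂ {y | ∃ R S T, ∃ c ∈ inv3 X R S T, ∃ c' ∈ inv3 X R S T,
      y = couple X R S T c c'} with hW
  -- Two-sided averaging sends a Fourier element to a coupling of two group sums, which are
  -- invariant; the inverse on h matches `couple_mul_diag`. On 𝒦(n) the same average is
  -- multiplication by (n!)², which is invertible.
  have key : ∀ y : Tri n, ∑ g : Equiv.Perm (Fin n), ∑ h : Equiv.Perm (Fin n),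
      diag g * y * diag h⁻¹ ∈ W := by
    intro y
    induction span_fourier3 X y using Submodule.span_induction with
    | mem y hy =>
      obtain ⟨R, S, T, i, j, rfl⟩ := hy
      have h1 : ∑ g : Equiv.Perm (Fin n), ∑ h : Equiv.Perm (Fin n),
          diag g * fourier3 X R S T i j * diag h⁻¹ = couple X R S T
          (∑ g, actArr X R S T g (EuclideanSpace.single i 1))
          (∑ h, actArr X R S T h (EuclideanSpace.single j 1)) := by
        rw [map_sum (couple X R S T), LinearMap.sum_apply]
        refine Finset.sum_congr rfl fun g _ => ?_
        rw [map_sum]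
        refine Finset.sum_congr rfl fun h _ => ?_
        rw [← couple_single, diag_mul_couple, couple_mul_diag, inv_inv]
      rw [h1]
      exact Submodule.subset_span ⟨R, S, T, _, sum_actArr_mem_inv3 X _, _,
        sum_actArr_mem_inv3 X _, rfl⟩
    | zero => simp
    | add y z _ _ hy hz =>
      simp only [mul_add, add_mul, Finset.sum_add_distrib]
      exact add_mem hy hz
    | smul r y _ hy =>
      simp only [mul_smul_comm, smul_mul_assoc, ← Finset.smul_sum]
      exact Submodule.smul_mem _ _ hy
  have h := key x
  simp only [hx.1, hx.2, Finset.sum_const, Finset.card_univ] at h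
  have hc : ((Fintype.card (Equiv.Perm (Fin n)) : ℂ)) ≠ 0 := by
    exact_mod_cast Fintype.card_ne_zero
  rw [← Nat.cast_smul_eq_nsmul ℂ, ← Nat.cast_smul_eq_nsmul ℂ] at h
  exact (Submodule.smul_mem_iff _ hc).1 ((Submodule.smul_mem_iff _ hc).1 h)

/-! ### Permutations of the tensor slots -/

/-- Exchange of the first two indices. -/
def swapArr (R S T : ι) : Arr X R S T →ₗ[ℂ] Arr X S R T where
  toFun c := WithLp.toLp 2 fun i => c (i.2.1, i.1, i.2.2)
  map_add' _ _ := rfl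
  map_smul' _ _ := rfl

/-- Exchange of the last two indices. -/
def swapArr' (R S T : ι) : Arr X R S T →ₗ[ℂ] Arr X R T S where
  toFun c := WithLp.toLp 2 fun i => c (i.1, i.2.2, i.2.1)
  map_add' _ _ := rfl
  map_smul' _ _ := rfl

lemma swapArr_apply (c : Arr X R S T) (i) : swapArr X R S T c i = c (i.2.1, i.1, i.2.2) := rfl

lemma swapArr'_apply (c : Arr X R S T) (i) : swapArr' X R S T c i = c (i.1, i.2.2, i.2.1) := rfl

lemma swapArr_mem {c : Arr X R S T} (hc : c ∈ inv3 X R S T) :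
    swapArr X R S T c ∈ inv3 X S R T := by
  intro g i
  refine Eq.trans ?_ (hc g (i.2.1, i.1, i.2.2))
  refine Fintype.sum_equiv ⟨fun i => (i.2.1, i.1, i.2.2), fun i => (i.2.1, i.1, i.2.2),
    fun _ => rfl, fun _ => rfl⟩ _ _ fun j => ?_
  rw [swapArr_apply]
  simp only [Equiv.coe_fn_mk]
  ring

lemma swapArr'_mem {c : Arr X R S T} (hc : c ∈ inv3 X R S T) :
    swapArr' X R S T c ∈ inv3 X R T S := by
  intro g i
  refine Eq.trans ?_ (hc g (i.1, i.2.2, i.2.1))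
  refine Fintype.sum_equiv ⟨fun i => (i.1, i.2.2, i.2.1), fun i => (i.1, i.2.2, i.2.1),
    fun _ => rfl, fun _ => rfl⟩ _ _ fun j => ?_
  rw [swapArr'_apply]
  simp only [Equiv.coe_fn_mk]
  ring

/-- A permutation of the slots also changes the type of the arrays, so for general labels only the
two adjacent transpositions are treated; they generate S₃. -/
lemma colour_swap_couple (c c' : Arr X R S T) :
    colour (Equiv.swap 0 1) (couple X R S T c c') =
      couple X S R T (swapArr X R S T c) (swapArr X R S T c') := by
  simp only [couple_apply, map_sum, map_smul]
  refine Fintype.sum_equiv ⟨fun i => (i.2.1, i.1, i.2.2), fun i => (i.2.1, i.1, i.2.2),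
    fun _ => rfl, fun _ => rfl⟩ _ _ fun i => ?_
  refine Fintype.sum_equiv ⟨fun i => (i.2.1, i.1, i.2.2), fun i => (i.2.1, i.1, i.2.2),
    fun _ => rfl, fun _ => rfl⟩ _ _ fun j => ?_
  refine congrArg _ ?_
  exact colour_tri (Equiv.swap 0 1) ![fourier X R i.1 j.1, fourier X S i.2.1 j.2.1,
    fourier X T i.2.2 j.2.2]

lemma colour_swap'_couple (c c' : Arr X R S T) :
    colour (Equiv.swap 1 2) (couple X R S T c c') =
      couple X R T S (swapArr' X R S T c) (swapArr' X R S T c') := by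
  simp only [couple_apply, map_sum, map_smul]
  refine Fintype.sum_equiv ⟨fun i => (i.1, i.2.2, i.2.1), fun i => (i.1, i.2.2, i.2.1),
    fun _ => rfl, fun _ => rfl⟩ _ _ fun i => ?_
  refine Fintype.sum_equiv ⟨fun i => (i.1, i.2.2, i.2.1), fun i => (i.1, i.2.2, i.2.1),
    fun _ => rfl, fun _ => rfl⟩ _ _ fun j => ?_
  refine congrArg _ ?_
  exact colour_tri (Equiv.swap 1 2) ![fourier X R i.1 j.1, fourier X S i.2.1 j.2.1,
    fourier X T i.2.2 j.2.2]

lemma colour_couple (a : Equiv.Perm (Fin 3)) (c c' : Arr X R R R) :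
    colour a (couple X R R R c c') =
      couple X R R R (permArr X R a c) (permArr X R a c') := by
  simp only [couple_apply, map_sum, map_smul]
  simp only [← (tripleEquiv (Fin (X.dim R))).sum_comp, tripleEquiv_apply]
  refine Fintype.sum_equiv (a.arrowCongr (Equiv.refl _)) _ _ fun i => ?_
  refine Fintype.sum_equiv (a.arrowCongr (Equiv.refl _)) _ _ fun j => ?_
  rw [permArr_apply, permArr_apply]
  simp only [Equiv.arrowCongr_apply, Function.comp_apply, Equiv.symm_apply_apply,
    Equiv.refl_apply]
  refine congrArg _ ?_
  exact colour_tri a fun k => fourier X R (i k) (j k)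

end Couple

/-! ### Averaging over the colour group -/

section Symmetrize

variable {n : ℕ}

/-- The sum over all permutations of the tensor slots. -/
def symmetrize : Tri n →ₗ[ℂ] Tri n := ∑ a : Equiv.Perm (Fin 3), (colour a).toLinearMap

lemma symmetrize_apply (x : Tri n) : symmetrize x = ∑ a, colour a x := by
  simp [symmetrize]

lemma colour_mul (a b : Equiv.Perm (Fin 3)) (x : Tri n) :
    colour (a * b) x = colour a (colour b x) := by
  induction x using MonoidAlgebra.induction_on with
  | of s =>
    rw [colour_of, colour_of, colour_of]
    rfl
  | add x y hx hy => rw [map_add, map_add, map_add, hx, hy]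
  | smul r x hx => rw [map_smul, map_smul, map_smul, hx]

lemma colour_one (x : Tri n) : colour 1 x = x := by
  induction x using MonoidAlgebra.induction_on with
  | of s => rw [colour_of]; rfl
  | add x y hx hy => rw [map_add, hx, hy]
  | smul r x hx => rw [map_smul, hx]

lemma colour_symmetrize (a : Equiv.Perm (Fin 3)) (x : Tri n) :
    colour a (symmetrize x) = symmetrize x := by
  simp only [symmetrize_apply, map_sum, ← colour_mul]
  exact Fintype.sum_equiv (Equiv.mulLeft a) _ _ fun b => rfl

lemma symmetrize_colour (a : Equiv.Perm (Fin 3)) (x : Tri n) :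
    symmetrize (colour a x) = symmetrize x := by
  simp only [symmetrize_apply, ← colour_mul]
  exact Fintype.sum_equiv (Equiv.mulRight a) _ _ fun b => rfl

/-- The second factor is already invariant and can be absorbed under the sum. Products of
symmetrisations thus reduce to one coupling times one symmetrisation. -/
lemma symmetrize_mul_symmetrize (x y : Tri n) :
    symmetrize x * symmetrize y = symmetrize (x * symmetrize y) := by
  simp only [symmetrize_apply x, Finset.sum_mul, symmetrize_apply (x * symmetrize y), map_mul,
    colour_symmetrize]

lemma symmetrize_of_mem {x : Tri n} (hx : x ∈ KSym n) : symmetrize x = (6 : ℂ) • x := by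
  rw [symmetrize_apply, Finset.sum_congr rfl fun a _ => hx.2 a, Finset.sum_const,
    Finset.card_univ, ← Nat.cast_smul_eq_nsmul ℂ, card_perm_three]

lemma colour_diag (a : Equiv.Perm (Fin 3)) (g : Equiv.Perm (Fin n)) :
    colour a (diag g) = diag g := by
  rw [diag, colour_of]; rfl

lemma colour_mem_K (a : Equiv.Perm (Fin 3)) {x : Tri n} (hx : x ∈ K n) : colour a x ∈ K n :=
  ⟨fun g => by rw [← colour_diag a g, ← map_mul, hx.1],
    fun g => by rw [← colour_diag a g, ← map_mul, hx.2]⟩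

lemma symmetrize_mem {x : Tri n} (hx : x ∈ K n) : symmetrize x ∈ KSym n := by
  refine ⟨?_, fun a => colour_symmetrize a x⟩
  rw [symmetrize_apply]
  exact sum_mem fun a _ => colour_mem_K a hx

/-- The three terms are representatives of the left cosets of the stabiliser {1, (0 1)} of a type
(R,R,S). They give the three placements of S in the definition of `Q`. -/
lemma sum_perm_three {M : Type*} [AddCommGroup M] [Module ℂ M] (f : Equiv.Perm (Fin 3) → M)
    (hf : ∀ a, f (a * Equiv.swap 0 1) = f a) :
    ∑ a, f a = (2 : ℂ) • (f 1 + f (Equiv.swap 1 2) + f (finRotate 3)) := by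
  have h : (Finset.univ : Finset (Equiv.Perm (Fin 3))) =
      {1, 1 * Equiv.swap 0 1, Equiv.swap 1 2, Equiv.swap 1 2 * Equiv.swap 0 1, finRotate 3,
        finRotate 3 * Equiv.swap 0 1} := by decide
  rw [h]
  repeat rw [Finset.sum_insert (by decide)]
  rw [Finset.sum_singleton, hf, hf, hf, two_smul]
  abel

lemma symmetrize_of_swap {x : Tri n} (hx : colour (Equiv.swap 0 1) x = x) :
    symmetrize x = (2 : ℂ) • (x + colour (Equiv.swap 1 2) x + colour (finRotate 3) x) := by
  rw [symmetrize_apply, sum_perm_three _ fun a => by rw [colour_mul, hx], colour_one]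

lemma perm_three_cases (b : Equiv.Perm (Fin 3)) :
    (b 0 = 0 ∧ b 1 = 1 ∧ b 2 = 2) ∨ (b 0 = 0 ∧ b 1 = 2 ∧ b 2 = 1) ∨
    (b 0 = 1 ∧ b 1 = 0 ∧ b 2 = 2) ∨ (b 0 = 1 ∧ b 1 = 2 ∧ b 2 = 0) ∨
    (b 0 = 2 ∧ b 1 = 0 ∧ b 2 = 1) ∨ (b 0 = 2 ∧ b 1 = 1 ∧ b 2 = 0) := by
  revert b; decide

end Symmetrize

/-! ### Types of blocks up to permutation of the slots -/

section BlockType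

variable {ι κ : Type*} [LinearOrder ι]

/-- The irreducible representations occurring in the three slots, for each block. -/
def blockType : Block ι κ → Fin 3 → ι
  | .three R S T _ => ![R, S, T]
  | .sym R S _ => ![R, R, S]
  | .alt R S _ => ![R, R, S]
  | .cube R _ => ![R, R, R]

/-- Two blocks of permuted types agree up to the choice of symmetry type. -/
lemma block_cases {b b' : Block ι κ} (a : Equiv.Perm (Fin 3))
    (h : blockType b = blockType b' ∘ a) : b = b' ∨
      (∃ R S h, b = .sym R S h ∧ b' = .alt R S h) ∨ (∃ R S h, b = .alt R S h ∧ b' = .sym R S h) ∨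
      ∃ R L L', L ≠ L' ∧ b = .cube R L ∧ b' = .cube R L' := by
  have h0 : blockType b 0 = blockType b' (a 0) := congrFun h 0
  have h1 : blockType b 1 = blockType b' (a 1) := congrFun h 1
  have h2 : blockType b 2 = blockType b' (a 2) := congrFun h 2
  -- Labels increase strictly in `three` and differ in `sym` and `alt`. Agreement up to permutation
  -- therefore forces the same irreducible representations and leaves only the symmetry type
  -- undetermined.
  rcases perm_three_cases a with ⟨e0, e1, e2⟩ | ⟨e0, e1, e2⟩ | ⟨e0, e1, e2⟩ | ⟨e0, e1, e2⟩ |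
    ⟨e0, e1, e2⟩ | ⟨e0, e1, e2⟩ <;> rw [e0] at h0 <;> rw [e1] at h1 <;> rw [e2] at h2 <;>
    clear h e0 e1 e2 <;>
    cases b <;> cases b' <;> simp only [blockType, Matrix.cons_val] at h0 h1 h2 <;>
    first
      | (exfalso; grind)
      | (left; congr; done)
      | (subst h0; subst h2; right; left; exact ⟨_, _, _, rfl, rfl⟩)
      | (subst h0; subst h2; right; right; left; exact ⟨_, _, _, rfl, rfl⟩)
      | (subst h0
         exact (em _).imp_right fun hne =>
           .inr (.inr ⟨_, _, _, fun h => hne (by rw [h]), rfl, rfl⟩))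

end BlockType

/-! ### Products of symmetrised couplings -/

section Products

variable {n : ℕ} {ι κ : Type*} (X : IrrepSystem (Equiv.Perm (Fin n)) ι)

/-- A slot carrying two different irreducible representations kills the product, because the
corresponding Fourier elements annihilate each other. -/
lemma couple_mul_colour_eq_zero {R S T R' S' T' : ι} (a : Equiv.Perm (Fin 3))
    (h : ∃ k, ![R, S, T] k ≠ ![R', S', T'] (a.symm k)) (c c' : Arr X R S T)
    (e e' : Arr X R' S' T') :
    couple X R S T c c' * colour a (couple X R' S' T' e e') = 0 := by
  obtain ⟨k, hk⟩ := h
  simp only [couple_apply, map_sum, map_smul, Finset.sum_mul, Finset.mul_sum,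
    smul_mul_smul_comm]
  refine Finset.sum_eq_zero fun i _ => Finset.sum_eq_zero fun j _ => Finset.sum_eq_zero fun l _ =>
    Finset.sum_eq_zero fun m _ => ?_
  let x : Fin 3 → MonoidAlgebra ℂ (Equiv.Perm (Fin n)) :=
    ![fourier X R l.1 m.1, fourier X S l.2.1 m.2.1, fourier X T l.2.2 m.2.2]
  let y : Fin 3 → MonoidAlgebra ℂ (Equiv.Perm (Fin n)) :=
    ![fourier X R' i.1 j.1, fourier X S' i.2.1 j.2.1, fourier X T' i.2.2 j.2.2]
  have hxy : ∀ k l, ![R, S, T] k ≠ ![R', S', T'] l → x k * y l = 0 := by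
    intro k l hkl
    fin_cases k <;> fin_cases l <;> exact fourier_mul_of_ne X hkl _ _ _ _
  have h1 : fourier3 X R S T l m * colour a (fourier3 X R' S' T' i j) =
      tri (x 0 * y (a.symm 0)) (x 1 * y (a.symm 1)) (x 2 * y (a.symm 2)) := by
    rw [← tri_mul]
    exact congrArg _ (colour_tri a y)
  have h2 := hxy _ _ hk
  rw [h1, tri_eq_slot]
  fin_cases k
  · change x 0 * y (a.symm 0) = 0 at h2
    simp [h2]
  · change x 1 * y (a.symm 1) = 0 at h2
    simp [h2]
  · change x 2 * y (a.symm 2) = 0 at h2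
    simp [h2]

lemma couple_mul_symmetrize_eq_zero {R S T R' S' T' : ι}
    (h : ∀ b : Equiv.Perm (Fin 3), ![R, S, T] ≠ ![R', S', T'] ∘ b) (c c' : Arr X R S T)
    (e e' : Arr X R' S' T') :
    couple X R S T c c' * symmetrize (couple X R' S' T' e e') = 0 := by
  rw [symmetrize_apply, Finset.mul_sum]
  exact Finset.sum_eq_zero fun a _ =>
    couple_mul_colour_eq_zero X a (Function.ne_iff.1 (h a.symm)) _ _ _ _

/-- The stabiliser of three distinct labels is trivial, so only the identity term of the
symmetrisation survives. -/
lemma couple_mul_symmetrize_three {R S T : ι} (hRS : R ≠ S) (hST : S ≠ T) (hRT : R ≠ T)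
    (c c' e e' : Arr X R S T) :
    couple X R S T c c' * symmetrize (couple X R S T e e') =
      inner ℂ c' e • couple X R S T c e' := by
  rw [symmetrize_apply, Finset.mul_sum, Finset.sum_eq_single 1, colour_one, couple_mul]
  · intro a _ ha
    refine couple_mul_colour_eq_zero X a ?_ _ _ _ _
    by_contra! h
    apply ha
    have hinj : Function.Injective ![R, S, T] := by
      intro k l hkl
      fin_cases k <;> fin_cases l <;>
        first
          | rfl
          | exact absurd hkl hRS
          | exact absurd hkl hST
          | exact absurd hkl hRT
          | exact absurd hkl.symm hRS
          | exact absurd hkl.symm hST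
          | exact absurd hkl.symm hRT
    ext k : 1
    have := hinj (h (a k))
    rwa [Equiv.symm_apply_apply] at this
  · simp

/-- Only the coset of the stabiliser {1, (0 1)} survives; its order is the factor 2. -/
lemma couple_mul_symmetrize_two {R S : ι} (hRS : R ≠ S) (c c' e e' : Arr X R R S)
    (he : colour (Equiv.swap 0 1) (couple X R R S e e') = couple X R R S e e') :
    couple X R R S c c' * symmetrize (couple X R R S e e') =
      (2 * inner ℂ c' e) • couple X R R S c e' := by
  rw [symmetrize_of_swap he, mul_smul_comm, mul_add, mul_add, couple_mul,
    couple_mul_colour_eq_zero X (Equiv.swap 1 2) ⟨1, hRS⟩,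
    couple_mul_colour_eq_zero X (finRotate 3) ⟨0, hRS⟩, add_zero, add_zero, smul_smul]

lemma swapArr_of_mem_invSym {R S : ι} {c : Arr X R R S} (hc : c ∈ invSym X R S) :
    swapArr X R R S c = c := PiLp.ext fun i => hc.2 i.1 i.2.1 i.2.2

lemma swapArr_of_mem_invAlt {R S : ι} {c : Arr X R R S} (hc : c ∈ invAlt X R S) :
    swapArr X R R S c = -c := PiLp.ext fun i => hc.2 i.1 i.2.1 i.2.2

lemma colour_swap_of_mem_invSym {R S : ι} {c c' : Arr X R R S} (hc : c ∈ invSym X R S)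
    (hc' : c' ∈ invSym X R S) :
    colour (Equiv.swap 0 1) (couple X R R S c c') = couple X R R S c c' := by
  rw [colour_swap_couple, swapArr_of_mem_invSym X hc, swapArr_of_mem_invSym X hc']

/-- The signs from the two antisymmetric arguments cancel. -/
lemma colour_swap_of_mem_invAlt {R S : ι} {c c' : Arr X R R S} (hc : c ∈ invAlt X R S)
    (hc' : c' ∈ invAlt X R S) :
    colour (Equiv.swap 0 1) (couple X R R S c c') = couple X R R S c c' := by
  rw [colour_swap_couple, swapArr_of_mem_invAlt X hc, swapArr_of_mem_invAlt X hc', map_neg,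
    map_neg, LinearMap.neg_apply, neg_neg]

lemma symmetrize_couple_two {R S : ι} {c c' : Arr X R R S}
    (h : colour (Equiv.swap 0 1) (couple X R R S c c') = couple X R R S c c') :
    symmetrize (couple X R R S c c') = (2 : ℂ) • ∑ i, ∑ j, (c i * conj (c' j)) •
      (tri (fourier X R i.1 j.1) (fourier X R i.2.1 j.2.1) (fourier X S i.2.2 j.2.2) +
       tri (fourier X R i.1 j.1) (fourier X S i.2.2 j.2.2) (fourier X R i.2.1 j.2.1) +
       tri (fourier X S i.2.2 j.2.2) (fourier X R i.1 j.1) (fourier X R i.2.1 j.2.1)) := by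
  rw [symmetrize_of_swap h]
  congr 1
  have h1 : ∀ i j, colour (Equiv.swap 1 2) (fourier3 X R R S i j) =
      tri (fourier X R i.1 j.1) (fourier X S i.2.2 j.2.2) (fourier X R i.2.1 j.2.1) := fun i j =>
    colour_tri (Equiv.swap 1 2) ![fourier X R i.1 j.1, fourier X R i.2.1 j.2.1,
      fourier X S i.2.2 j.2.2]
  have h2 : ∀ i j, colour (finRotate 3) (fourier3 X R R S i j) =
      tri (fourier X S i.2.2 j.2.2) (fourier X R i.1 j.1) (fourier X R i.2.1 j.2.1) := fun i j =>
    colour_tri (finRotate 3) ![fourier X R i.1 j.1, fourier X R i.2.1 j.2.1,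
      fourier X S i.2.2 j.2.2]
  simp only [couple_apply, map_sum, map_smul, h1, h2, smul_add, Finset.sum_add_distrib]
  rfl

variable [LinearOrder ι] [Fintype κ] {Y : IrrepSystem (Equiv.Perm (Fin 3)) κ} (C : CGSystem X Y)

lemma Q_three {R S T : ι} (h : R < S ∧ S < T) (t₁ t₂) :
    Q X C (.three R S T h) t₁ t₂ =
      symmetrize (couple X R S T (C.three R S T h.1 h.2 t₁) (C.three R S T h.1 h.2 t₂)) := by
  simp only [couple_apply, map_sum, map_smul, symmetrize_apply]
  rfl

/-- `Q` sums over the three cosets and `symmetrize` over all six permutations, whence the factor 2.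
-/
lemma Q_sym {R S : ι} (h : R ≠ S) (t₁ t₂) :
    symmetrize (couple X R R S (C.sym R S h t₁) (C.sym R S h t₂)) =
      (2 : ℂ) • Q X C (.sym R S h) t₁ t₂ :=
  symmetrize_couple_two X (colour_swap_of_mem_invSym X (C.sym R S h t₁).2 (C.sym R S h t₂).2)

lemma Q_alt {R S : ι} (h : R ≠ S) (t₁ t₂) :
    symmetrize (couple X R R S (C.alt R S h t₁) (C.alt R S h t₂)) =
      (2 : ℂ) • Q X C (.alt R S h) t₁ t₂ :=
  symmetrize_couple_two X (colour_swap_of_mem_invAlt X (C.alt R S h t₁).2 (C.alt R S h t₂).2)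

lemma Q_cube (R : ι) (L : κ) (t₁ t₂ : Fin (multCube X Y R L)) :
    Q X C (.cube R L) t₁ t₂ = ∑ m, couple X R R R (C.cube R ⟨L, t₁, m⟩) (C.cube R ⟨L, t₂, m⟩) := by
  simp only [couple_apply]
  symm
  rw [Finset.sum_comm]
  refine Finset.sum_congr rfl fun i _ => ?_
  rw [Finset.sum_comm]
  rfl

lemma permArr_cube (R : ι) (L : κ) (t : Fin (multCube X Y R L)) (m : Fin (Y.dim L))
    (a : Equiv.Perm (Fin 3)) :
    permArr X R a (C.cube R ⟨L, t, m⟩) = ∑ p, Y.entry L a p m • (C.cube R ⟨L, t, p⟩ : Arr X R R R) := by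
  refine permArr_ext X fun i => ?_
  rw [permArr_apply, C.cube_equivariant]
  simp only [WithLp.ofLp_sum, WithLp.ofLp_smul, Finset.sum_apply, Pi.smul_apply, smul_eq_mul]

/-- The two arguments transform by D^Λ and the conjugate of D^Λ', so averaging produces the sums
evaluated by Schur orthogonality for S₃. They vanish for Λ ≠ Λ' and otherwise contribute 6/dim Λ on
the diagonal. -/
lemma symmetrize_couple_cube (R : ι) (L L' : κ) (t : Fin (multCube X Y R L))
    (t' : Fin (multCube X Y R L')) (m : Fin (Y.dim L)) (m' : Fin (Y.dim L')) :
    symmetrize (couple X R R R (C.cube R ⟨L, t, m⟩) (C.cube R ⟨L', t', m'⟩)) =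
      ∑ p, ∑ p', (∑ a, Y.entry L a p m * conj (Y.entry L' a p' m')) •
        couple X R R R (C.cube R ⟨L, t, p⟩) (C.cube R ⟨L', t', p'⟩) := by
  have h : ∀ a, colour a (couple X R R R (C.cube R ⟨L, t, m⟩) (C.cube R ⟨L', t', m'⟩)) =
      ∑ p, ∑ p', (Y.entry L a p m * conj (Y.entry L' a p' m')) •
        couple X R R R (C.cube R ⟨L, t, p⟩) (C.cube R ⟨L', t', p'⟩) := by
    intro a
    rw [colour_couple, permArr_cube, permArr_cube, map_sum (couple X R R R), LinearMap.sum_apply]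
    refine Finset.sum_congr rfl fun p _ => ?_
    rw [map_smul, LinearMap.smul_apply, map_sum, Finset.smul_sum]
    refine Finset.sum_congr rfl fun p' _ => ?_
    rw [LinearMap.map_smulₛₗ, smul_smul]
  rw [symmetrize_apply, Finset.sum_congr rfl fun a _ => h a, Finset.sum_comm]
  refine Finset.sum_congr rfl fun p _ => ?_
  rw [Finset.sum_comm]
  exact Finset.sum_congr rfl fun p' _ => (Finset.sum_smul ..).symm

lemma symmetrize_couple_cube_of_ne (R : ι) {L L' : κ} (h : L ≠ L') (t : Fin (multCube X Y R L))
    (t' : Fin (multCube X Y R L')) (m : Fin (Y.dim L)) (m' : Fin (Y.dim L')) :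
    symmetrize (couple X R R R (C.cube R ⟨L, t, m⟩) (C.cube R ⟨L', t', m'⟩)) = 0 := by
  rw [symmetrize_couple_cube]
  simp [entry_orthogonal_of_ne Y h]

lemma symmetrize_couple_cube_eq (R : ι) (L : κ) (t t' : Fin (multCube X Y R L))
    (m m' : Fin (Y.dim L)) :
    symmetrize (couple X R R R (C.cube R ⟨L, t, m⟩) (C.cube R ⟨L, t', m'⟩)) =
      (if m = m' then (6 : ℂ) / Y.dim L else 0) • Q X C (.cube R L) t t' := by
  rw [symmetrize_couple_cube, Q_cube, Finset.smul_sum]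
  refine Finset.sum_congr rfl fun p _ => ?_
  rw [Finset.sum_eq_single p]
  · simp [entry_orthogonal, card_perm_three]
  · intro q _ hq
    simp [entry_orthogonal, hq.symm]
  · simp

lemma Q_cube_eq_smul (R : ι) (L : κ) (t t' : Fin (multCube X Y R L)) (m : Fin (Y.dim L)) :
    Q X C (.cube R L) t t' = ((Y.dim L : ℂ) / 6) •
      symmetrize (couple X R R R (C.cube R ⟨L, t, m⟩) (C.cube R ⟨L, t', m⟩)) := by
  have hd : (Y.dim L : ℂ) ≠ 0 := by exact_mod_cast (Y.dim_pos L).ne'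
  rw [symmetrize_couple_cube_eq, if_pos rfl, smul_smul, div_mul_div_cancel₀ (by norm_num),
    div_self hd, one_smul]

lemma inner_cube (R : ι) (x y) : inner ℂ (C.cube R x : Arr X R R R) (C.cube R y : Arr X R R R) =
    @ite ℂ (x = y) (Classical.propDecidable _) 1 0 := by
  classical
  rw [← Submodule.coe_inner, orthonormal_iff_ite.1 (C.cube R).orthonormal]
  congr

/-- All four kinds are scalar multiples of one symmetrised coupling, with scalars 1, 1/2, 1/2 and
dim Λ/6. Membership in 𝒦_{Y₀}(n) and vanishing for unrelated types then need no further case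
analysis. -/
lemma exists_Q_eq (b : Block ι κ) (t₁ t₂) : ∃ (R S T : ι) (c c' : Arr X R S T) (z : ℂ),
    blockType b = ![R, S, T] ∧ c ∈ inv3 X R S T ∧ c' ∈ inv3 X R S T ∧
      Q X C b t₁ t₂ = z • symmetrize (couple X R S T c c') := by
  cases b with
  | three R S T h =>
    exact ⟨R, S, T, _, _, 1, rfl, Subtype.mem _, Subtype.mem _, by rw [one_smul, Q_three]⟩
  | sym R S h =>
    exact ⟨R, R, S, _, _, 2⁻¹, rfl, (C.sym R S h t₁).2.1, (C.sym R S h t₂).2.1,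
      ((inv_smul_eq_iff₀ two_ne_zero).2 (Q_sym X C h t₁ t₂)).symm⟩
  | alt R S h =>
    exact ⟨R, R, S, _, _, 2⁻¹, rfl, (C.alt R S h t₁).2.1, (C.alt R S h t₂).2.1,
      ((inv_smul_eq_iff₀ two_ne_zero).2 (Q_alt X C h t₁ t₂)).symm⟩
  | cube R L =>
    exact ⟨R, R, R, _, _, _, rfl, Subtype.mem _, Subtype.mem _,
      Q_cube_eq_smul X C R L t₁ t₂ ⟨0, Y.dim_pos L⟩⟩

lemma Q_mem (b : Block ι κ) (t₁ t₂) : Q X C b t₁ t₂ ∈ KSym n := by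
  obtain ⟨R, S, T, c, c', z, -, hc, hc', h⟩ := exists_Q_eq X C b t₁ t₂
  rw [h]
  exact SMulMemClass.smul_mem z (symmetrize_mem (couple_mem_K X hc hc'))

lemma Q_mul_eq_zero_of_type {b b' : Block ι κ}
    (h : ∀ a : Equiv.Perm (Fin 3), blockType b ≠ blockType b' ∘ a) (t₁ t₂ t₃ t₄) :
    Q X C b t₁ t₂ * Q X C b' t₃ t₄ = 0 := by
  obtain ⟨R, S, T, c, c', z, h1, -, -, hQ⟩ := exists_Q_eq X C b t₁ t₂
  obtain ⟨R', S', T', e, e', z', h2, -, -, hQ'⟩ := exists_Q_eq X C b' t₃ t₄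
  rw [h1, h2] at h
  rw [hQ, hQ', smul_mul_smul_comm, symmetrize_mul_symmetrize, couple_mul_symmetrize_eq_zero X h,
    map_zero, smul_zero]

end Products

/-! ### The matrix unit relations -/

section Products

variable {n : ℕ} {ι κ : Type*} (X : IrrepSystem (Equiv.Perm (Fin n)) ι)

/-- Reindexing the inner product by the flip changes its sign. -/
lemma inner_invSym_invAlt {R S : ι} {c d : Arr X R R S} (hc : c ∈ invSym X R S)
    (hd : d ∈ invAlt X R S) : inner ℂ c d = 0 ∧ inner ℂ d c = 0 := by
  have key : inner ℂ c d = -inner ℂ c d := by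
    conv_rhs => rw [← inner_neg_right]
    simp only [PiLp.inner_apply]
    refine Fintype.sum_equiv ⟨fun i => (i.2.1, i.1, i.2.2), fun i => (i.2.1, i.1, i.2.2),
      fun _ => rfl, fun _ => rfl⟩ _ _ fun i => ?_
    simp only [Equiv.coe_fn_mk, PiLp.neg_apply, hc.2 i.1 i.2.1 i.2.2, hd.2 i.1 i.2.1 i.2.2,
      neg_neg]
  have h : inner ℂ c d = 0 := self_eq_neg.1 key
  exact ⟨h, inner_eq_zero_symm.1 h⟩

variable [LinearOrder ι] [Fintype κ] {Y : IrrepSystem (Equiv.Perm (Fin 3)) κ} (C : CGSystem X Y)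

/-- If the types are not permutations of each other, every term has a mismatched slot. Otherwise the
blocks differ only in symmetry type, and the coefficient vectors are orthogonal. -/
lemma Q_mul_of_ne {b b' : Block ι κ} (h : b ≠ b') (t₁ t₂ t₃ t₄) :
    Q X C b t₁ t₂ * Q X C b' t₃ t₄ = 0 := by
  by_cases hp : ∀ a : Equiv.Perm (Fin 3), blockType b ≠ blockType b' ∘ a
  · exact Q_mul_eq_zero_of_type X C hp _ _ _ _
  push Not at hp
  obtain ⟨a, ha⟩ := hp
  -- One factor 2 for each of the two elements, to replace both by symmetrisations through `Q_sym`
  -- and `Q_alt`.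
  have h2 : (2 : ℂ) • (2 : ℂ) • (Q X C b t₁ t₂ * Q X C b' t₃ t₄) = 0 →
      Q X C b t₁ t₂ * Q X C b' t₃ t₄ = 0 := by simp
  rcases block_cases a ha with rfl | ⟨R, S, hRS, rfl, rfl⟩ | ⟨R, S, hRS, rfl, rfl⟩ |
    ⟨R, L, L', hL, rfl, rfl⟩
  · exact absurd rfl h
  · apply h2
    rw [← mul_smul_comm, ← smul_mul_assoc]
    refine (congrArg₂ _ (Q_sym X C hRS t₁ t₂).symm (Q_alt X C hRS t₃ t₄).symm).trans ?_
    rw [symmetrize_mul_symmetrize, couple_mul_symmetrize_two X hRS,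
      (inner_invSym_invAlt X (Subtype.mem _) (Subtype.mem _)).1, mul_zero, zero_smul, map_zero]
    exact colour_swap_of_mem_invAlt X (Subtype.mem _) (Subtype.mem _)
  · apply h2
    rw [← mul_smul_comm, ← smul_mul_assoc]
    refine (congrArg₂ _ (Q_alt X C hRS t₁ t₂).symm (Q_sym X C hRS t₃ t₄).symm).trans ?_
    rw [symmetrize_mul_symmetrize, couple_mul_symmetrize_two X hRS,
      (inner_invSym_invAlt X (Subtype.mem _) (Subtype.mem _)).2, mul_zero, zero_smul, map_zero]
    exact colour_swap_of_mem_invSym X (Subtype.mem _) (Subtype.mem _)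
  · refine (congrArg₂ _ (Q_cube X C R L t₁ t₂) (Q_cube X C R L' t₃ t₄)).trans ?_
    rw [Finset.sum_mul_sum]
    refine Finset.sum_eq_zero fun m _ => Finset.sum_eq_zero fun m' _ => ?_
    rw [couple_mul, inner_cube, if_neg, zero_smul]
    intro h'
    exact hL (congrArg Sigma.fst h')

lemma inner_orthonormalBasis {V σ : Type*} [NormedAddCommGroup V] [InnerProductSpace ℂ V]
    [Fintype σ] [DecidableEq σ] {N : Submodule ℂ V} (v : OrthonormalBasis σ ℂ N) (s t : σ) :
    inner ℂ (v s : V) (v t : V) = if s = t then (1 : ℂ) else 0 := by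
  rw [← Submodule.coe_inner, orthonormal_iff_ite.1 v.orthonormal]

/-- In each kind the product reduces to the inner product of the middle coefficient vectors, which
orthonormality makes a Kronecker delta. -/
lemma Q_mul (b : Block ι κ) (t₁ t₂ t₃ t₄) :
    Q X C b t₁ t₂ * Q X C b t₃ t₄ = if t₂ = t₃ then Q X C b t₁ t₄ else 0 := by
  cases b with
  | three R S T h =>
    -- The index type `Fin (blockSize X Y b)` agrees with this one only by unfolding, so the claim
    -- is restated in a form that rewriting can match.
    have key : ∀ t₁ t₂ t₃ t₄ : Fin (kron X R S T),
        Q X C (.three R S T h) t₁ t₂ * Q X C (.three R S T h) t₃ t₄ =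
          if t₂ = t₃ then Q X C (.three R S T h) t₁ t₄ else 0 := by
      intro t₁ t₂ t₃ t₄
      refine (congrArg₂ _ (Q_three X C h t₁ t₂) (Q_three X C h t₃ t₄)).trans ?_
      rw [symmetrize_mul_symmetrize,
        couple_mul_symmetrize_three X h.1.ne h.2.ne (h.1.trans h.2).ne, map_smul,
        inner_orthonormalBasis, ite_smul, one_smul, zero_smul]
      exact if_congr Iff.rfl (Q_three X C h t₁ t₄).symm rfl
    exact key t₁ t₂ t₃ t₄
  | sym R S h =>
    have key : ∀ t₁ t₂ t₃ t₄ : Fin (multSym X R S),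
        Q X C (.sym R S h) t₁ t₂ * Q X C (.sym R S h) t₃ t₄ =
          if t₂ = t₃ then Q X C (.sym R S h) t₁ t₄ else 0 := by
      intro t₁ t₂ t₃ t₄
      have h2 : (2 : ℂ) • (2 : ℂ) • (Q X C (.sym R S h) t₁ t₂ * Q X C (.sym R S h) t₃ t₄) =
          (2 : ℂ) • (2 : ℂ) • if t₂ = t₃ then Q X C (.sym R S h) t₁ t₄ else 0 := by
        rw [← mul_smul_comm, ← smul_mul_assoc]
        refine (congrArg₂ _ (Q_sym X C h t₁ t₂).symm (Q_sym X C h t₃ t₄).symm).trans ?_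
        rw [symmetrize_mul_symmetrize, couple_mul_symmetrize_two X h, map_smul, mul_smul,
          inner_orthonormalBasis, Q_sym, ite_smul, one_smul, zero_smul, smul_ite, smul_zero]
        · split_ifs <;> simp only [smul_zero]
        · exact colour_swap_of_mem_invSym X (Subtype.mem _) (Subtype.mem _)
      exact smul_right_injective _ two_ne_zero (smul_right_injective _ two_ne_zero h2)
    exact key t₁ t₂ t₃ t₄
  | alt R S h =>
    have key : ∀ t₁ t₂ t₃ t₄ : Fin (multAlt X R S),
        Q X C (.alt R S h) t₁ t₂ * Q X C (.alt R S h) t₃ t₄ =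
          if t₂ = t₃ then Q X C (.alt R S h) t₁ t₄ else 0 := by
      intro t₁ t₂ t₃ t₄
      have h2 : (2 : ℂ) • (2 : ℂ) • (Q X C (.alt R S h) t₁ t₂ * Q X C (.alt R S h) t₃ t₄) =
          (2 : ℂ) • (2 : ℂ) • if t₂ = t₃ then Q X C (.alt R S h) t₁ t₄ else 0 := by
        rw [← mul_smul_comm, ← smul_mul_assoc]
        refine (congrArg₂ _ (Q_alt X C h t₁ t₂).symm (Q_alt X C h t₃ t₄).symm).trans ?_
        rw [symmetrize_mul_symmetrize, couple_mul_symmetrize_two X h, map_smul, mul_smul,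
          inner_orthonormalBasis, Q_alt, ite_smul, one_smul, zero_smul, smul_ite, smul_zero]
        · split_ifs <;> simp only [smul_zero]
        · exact colour_swap_of_mem_invAlt X (Subtype.mem _) (Subtype.mem _)
      exact smul_right_injective _ two_ne_zero (smul_right_injective _ two_ne_zero h2)
    exact key t₁ t₂ t₃ t₄
  | cube R L =>
    have key : ∀ t₁ t₂ t₃ t₄ : Fin (multCube X Y R L),
        Q X C (.cube R L) t₁ t₂ * Q X C (.cube R L) t₃ t₄ =
          if t₂ = t₃ then Q X C (.cube R L) t₁ t₄ else 0 := by
      intro t₁ t₂ t₃ t₄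
      rw [Q_cube, Q_cube, Q_cube, Finset.sum_mul_sum]
      simp only [couple_mul, inner_cube, Sigma.mk.injEq, heq_eq_eq, true_and, Prod.mk.injEq]
      split_ifs with h
      · refine Finset.sum_congr rfl fun m _ => ?_
        rw [Finset.sum_eq_single m]
        · simp [h]
        · intro m' _ hm
          simp [hm.symm]
        · simp
      · simp [h]
    exact key t₁ t₂ t₃ t₄

/-- Multiplying on the left by the coupling of the same unit vector with itself returns a nonzero
multiple of that coupling, which does not vanish. -/
lemma Q_self_ne_zero (b : Block ι κ) (t) : Q X C b t t ≠ 0 := by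
  cases b with
  | three R S T h =>
    have key : ∀ t : Fin (kron X R S T), Q X C (.three R S T h) t t ≠ 0 := by
      intro t h0
      have h1 : couple X R S T (C.three R S T h.1 h.2 t) (C.three R S T h.1 h.2 t) *
          Q X C (.three R S T h) t t = couple X R S T (C.three R S T h.1 h.2 t)
            (C.three R S T h.1 h.2 t) := by
        refine (congrArg _ (Q_three X C h t t)).trans ?_
        rw [couple_mul_symmetrize_three X h.1.ne h.2.ne (h.1.trans h.2).ne,
          inner_orthonormalBasis, if_pos rfl, one_smul]
      rw [h0, mul_zero] at h1
      refine couple_self_ne_zero X ?_ h1.symm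
      rw [inner_orthonormalBasis, if_pos rfl]
    exact key t
  | sym R S h =>
    have key : ∀ t : Fin (multSym X R S), Q X C (.sym R S h) t t ≠ 0 := by
      intro t h0
      have h1 := Q_sym X C h t t
      have h2 := couple_mul_symmetrize_two X h (C.sym R S h t) (C.sym R S h t) (C.sym R S h t)
        (C.sym R S h t) (colour_swap_of_mem_invSym X (Subtype.mem _) (Subtype.mem _))
      rw [h1, h0, smul_zero, mul_zero, inner_orthonormalBasis, if_pos rfl, eq_comm, smul_eq_zero] at h2
      refine couple_self_ne_zero X ?_ (h2.resolve_left (by norm_num))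
      rw [inner_orthonormalBasis, if_pos rfl]
    exact key t
  | alt R S h =>
    have key : ∀ t : Fin (multAlt X R S), Q X C (.alt R S h) t t ≠ 0 := by
      intro t h0
      have h1 := Q_alt X C h t t
      have h2 := couple_mul_symmetrize_two X h (C.alt R S h t) (C.alt R S h t) (C.alt R S h t)
        (C.alt R S h t) (colour_swap_of_mem_invAlt X (Subtype.mem _) (Subtype.mem _))
      rw [h1, h0, smul_zero, mul_zero, inner_orthonormalBasis, if_pos rfl, eq_comm, smul_eq_zero] at h2
      refine couple_self_ne_zero X ?_ (h2.resolve_left (by norm_num))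
      rw [inner_orthonormalBasis, if_pos rfl]
    exact key t
  | cube R L =>
    have key : ∀ t : Fin (multCube X Y R L), Q X C (.cube R L) t t ≠ 0 := by
      intro t h0
      let m : Fin (Y.dim L) := ⟨0, Y.dim_pos L⟩
      have h1 : couple X R R R (C.cube R ⟨L, t, m⟩) (C.cube R ⟨L, t, m⟩) *
          Q X C (.cube R L) t t = couple X R R R (C.cube R ⟨L, t, m⟩) (C.cube R ⟨L, t, m⟩) := by
        rw [Q_cube, Finset.mul_sum, Finset.sum_eq_single m, couple_mul, inner_cube, if_pos rfl,
          one_smul]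
        · intro m' _ hm
          rw [couple_mul, inner_cube, if_neg, zero_smul]
          simpa using hm.symm
        · simp
      rw [h0, mul_zero] at h1
      refine couple_self_ne_zero X ?_ h1.symm
      rw [inner_cube, if_pos rfl]
    exact key t

end Products

/-- Sesquilinear expansion; it reduces the spanning statements to Clebsch-Gordan vectors. -/
lemma apply_mem_of_orthonormalBasis {V M σ τ : Type*} [NormedAddCommGroup V]
    [InnerProductSpace ℂ V] [AddCommGroup M] [Module ℂ M] [Fintype σ] [Fintype τ]
    {N N' : Submodule ℂ V} (v : OrthonormalBasis σ ℂ N) (w : OrthonormalBasis τ ℂ N')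
    (f : V →ₗ[ℂ] V →ₛₗ[starRingEnd ℂ] M) (W : Submodule ℂ M)
    (h : ∀ s t, f (v s) (w t) ∈ W) {c c' : V} (hc : c ∈ N) (hc' : c' ∈ N') : f c c' ∈ W := by
  have h1 : c = ∑ s, v.repr ⟨c, hc⟩ s • (v s : V) := by
    conv_lhs => rw [show c = ((⟨c, hc⟩ : N) : V) from rfl, ← v.sum_repr ⟨c, hc⟩]
    simp
  have h2 : c' = ∑ t, w.repr ⟨c', hc'⟩ t • (w t : V) := by
    conv_lhs => rw [show c' = ((⟨c', hc'⟩ : N') : V) from rfl, ← w.sum_repr ⟨c', hc'⟩]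
    simp
  rw [h1, h2, map_sum f, LinearMap.sum_apply]
  refine sum_mem fun s _ => ?_
  rw [map_smul, LinearMap.smul_apply, map_sum]
  refine W.smul_mem _ (sum_mem fun t _ => ?_)
  rw [LinearMap.map_smulₛₗ]
  exact W.smul_mem _ (h s t)

/-! ### Spanning and linear independence -/

section Span

variable {n : ℕ} {ι κ : Type*} (X : IrrepSystem (Equiv.Perm (Fin n)) ι)

lemma exists_add_of_mem_inv3 {R S : ι} {c : Arr X R R S} (hc : c ∈ inv3 X R R S) :
    ∃ s ∈ invSym X R S, ∃ a ∈ invAlt X R S, c = s + a := by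
  have hs := swapArr_mem X hc
  refine ⟨(2⁻¹ : ℂ) • (c + swapArr X R R S c), ⟨Submodule.smul_mem _ _ (add_mem hc hs),
    fun i j k => ?_⟩, (2⁻¹ : ℂ) • (c - swapArr X R R S c),
    ⟨Submodule.smul_mem _ _ (sub_mem hc hs), fun i j k => ?_⟩, ?_⟩
  · simp only [PiLp.smul_apply, PiLp.add_apply, swapArr_apply, add_comm]
  · simp only [PiLp.smul_apply, PiLp.sub_apply, swapArr_apply, ← smul_neg, neg_sub]
  · rw [← smul_add, add_add_sub_cancel, ← two_smul ℂ c, inv_smul_smul₀ two_ne_zero]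

/-- The flip negates a mixed coupling but does not affect its symmetrisation, so symmetric and
antisymmetric parts do not mix. -/
lemma symmetrize_couple_invSym_invAlt {R S : ι} {s a : Arr X R R S} (hs : s ∈ invSym X R S)
    (ha : a ∈ invAlt X R S) :
    symmetrize (couple X R R S s a) = 0 ∧ symmetrize (couple X R R S a s) = 0 := by
  have h1 := symmetrize_colour (Equiv.swap 0 1) (couple X R R S s a)
  have h2 := symmetrize_colour (Equiv.swap 0 1) (couple X R R S a s)
  rw [colour_swap_couple, swapArr_of_mem_invSym X hs, swapArr_of_mem_invAlt X ha] at h1 h2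
  rw [map_neg, map_neg] at h1
  rw [map_neg, LinearMap.neg_apply, map_neg] at h2
  have key : ∀ x : Tri n, -x = x → x = 0 := fun x hx => by
    have h : (2 : ℂ) • x = 0 := by rw [two_smul]; nth_rw 1 [← hx]; exact neg_add_cancel x
    exact (smul_eq_zero.1 h).resolve_left two_ne_zero
  exact ⟨key _ h1, key _ h2⟩

variable [LinearOrder ι] [Fintype κ] {Y : IrrepSystem (Equiv.Perm (Fin 3)) κ} (C : CGSystem X Y)

/-- The span of the refined Clebsch-Gordan elements. -/
def spanQ : Submodule ℂ (Tri n) :=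
  Submodule.span ℂ (Set.range fun p : Σ b : Block ι κ,
    Fin (blockSize X Y b) × Fin (blockSize X Y b) => Q X C p.1 p.2.1 p.2.2)

lemma Q_mem_spanQ (b : Block ι κ) (t₁ t₂) : Q X C b t₁ t₂ ∈ spanQ X C :=
  Submodule.subset_span ⟨⟨b, t₁, t₂⟩, rfl⟩

/-- The symmetrisations of all couplings of type `(R, S, T)` lie in the span of the refined
Clebsch-Gordan elements. -/
def SpannedBy (R S T : ι) : Prop :=
  ∀ c ∈ inv3 X R S T, ∀ c' ∈ inv3 X R S T, symmetrize (couple X R S T c c') ∈ spanQ X C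

lemma SpannedBy.swap {R S T : ι} (h : SpannedBy X C R S T) : SpannedBy X C S R T := by
  intro c hc c' hc'
  rw [← symmetrize_colour (Equiv.swap 0 1), colour_swap_couple]
  exact h _ (swapArr_mem X hc) _ (swapArr_mem X hc')

lemma SpannedBy.swap' {R S T : ι} (h : SpannedBy X C R S T) : SpannedBy X C R T S := by
  intro c hc c' hc'
  rw [← symmetrize_colour (Equiv.swap 1 2), colour_swap'_couple]
  exact h _ (swapArr'_mem X hc) _ (swapArr'_mem X hc')

lemma spannedBy_three {R S T : ι} (h : R < S ∧ S < T) : SpannedBy X C R S T := by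
  intro c hc c' hc'
  refine apply_mem_of_orthonormalBasis (C.three R S T h.1 h.2) (C.three R S T h.1 h.2)
    (couple X R S T) ((spanQ X C).comap symmetrize) (fun s t => ?_) hc hc'
  rw [Submodule.mem_comap]
  exact (Q_three X C h s t).symm ▸ Q_mem_spanQ X C (.three R S T h) s t

lemma spannedBy_two {R S : ι} (h : R ≠ S) : SpannedBy X C R R S := by
  intro c hc c' hc'
  obtain ⟨s, hs, a, ha, rfl⟩ := exists_add_of_mem_inv3 X hc
  obtain ⟨s', hs', a', ha', rfl⟩ := exists_add_of_mem_inv3 X hc'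
  rw [map_add (couple X R R S), LinearMap.add_apply, map_add, map_add, map_add, map_add, map_add,
    (symmetrize_couple_invSym_invAlt X hs ha').1, (symmetrize_couple_invSym_invAlt X hs' ha).2,
    add_zero, zero_add]
  refine add_mem ?_ ?_
  · refine apply_mem_of_orthonormalBasis (C.sym R S h) (C.sym R S h)
      (couple X R R S) ((spanQ X C).comap symmetrize) (fun s t => ?_) hs hs'
    rw [Submodule.mem_comap, Q_sym X C h]
    exact Submodule.smul_mem _ _ (Q_mem_spanQ X C _ _ _)
  · refine apply_mem_of_orthonormalBasis (C.alt R S h) (C.alt R S h)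
      (couple X R R S) ((spanQ X C).comap symmetrize) (fun s t => ?_) ha ha'
    rw [Submodule.mem_comap, Q_alt X C h]
    exact Submodule.smul_mem _ _ (Q_mem_spanQ X C _ _ _)

lemma spannedBy_cube (R : ι) : SpannedBy X C R R R := by
  intro c hc c' hc'
  refine apply_mem_of_orthonormalBasis (C.cube R) (C.cube R)
    (couple X R R R) ((spanQ X C).comap symmetrize) ?_ hc hc'
  rintro ⟨L, t, m⟩ ⟨L', t', m'⟩
  rw [Submodule.mem_comap]
  by_cases h : L = L'
  · subst h
    rw [symmetrize_couple_cube_eq]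
    exact Submodule.smul_mem _ _ (Q_mem_spanQ X C _ _ _)
  · rw [symmetrize_couple_cube_of_ne X C R h]
    exact zero_mem _

/-- Adjacent transpositions, which leave the symmetrisation unchanged, bring any ordered triple to a
canonical one: increasing, or with its first two labels equal. -/
lemma spannedBy (R S T : ι) : SpannedBy X C R S T := by
  have two : ∀ R S, SpannedBy X C R R S := fun R S => by
    by_cases h : R = S
    · exact h ▸ spannedBy_cube X C R
    · exact spannedBy_two X C h
  rcases lt_trichotomy R S with h1 | rfl | h1
  · rcases lt_trichotomy S T with h2 | rfl | h2
    · exact spannedBy_three X C ⟨h1, h2⟩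
    · exact ((two S R).swap').swap
    · rcases lt_trichotomy R T with h3 | rfl | h3
      · exact (spannedBy_three X C ⟨h3, h2⟩).swap'
      · exact (two R S).swap'
      · exact ((spannedBy_three X C ⟨h3, h1⟩).swap).swap'
  · exact two R T
  · rcases lt_trichotomy R T with h2 | rfl | h2
    · exact (spannedBy_three X C ⟨h1, h2⟩).swap
    · exact (two R S).swap'
    · rcases lt_trichotomy S T with h3 | rfl | h3
      · exact ((spannedBy_three X C ⟨h3, h2⟩).swap').swap
      · exact ((two S R).swap').swap
      · exact (((spannedBy_three X C ⟨h3, h1⟩).swap).swap').swap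

lemma mem_spanQ [Fintype ι] {x : Tri n} (hx : x ∈ KSym n) : x ∈ spanQ X C := by
  have h : ∀ y ∈ K n, symmetrize y ∈ spanQ X C := by
    intro y hy
    replace hy := mem_span_couple_of_mem_K X hy
    induction hy using Submodule.span_induction with
    | mem y hy =>
      obtain ⟨R, S, T, c, hc, c', hc', rfl⟩ := hy
      exact spannedBy X C R S T c hc c' hc'
    | zero => rw [map_zero]; exact zero_mem _
    | add y z _ _ hy hz => rw [map_add]; exact add_mem hy hz
    | smul r y _ hy => rw [map_smul]; exact Submodule.smul_mem _ _ hy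
  have h' := h x hx.1
  rw [symmetrize_of_mem hx] at h'
  exact (Submodule.smul_mem_iff _ (by norm_num)).1 h'

/-- Multiplying a relation by Q_{t₁t₁} on the left and Q_{t₂t₁} on the right isolates the
coefficient at (t₁, t₂), times the nonzero element Q_{t₁t₁}. -/
lemma linearIndependent_Q : LinearIndependent ℂ (fun p : Σ b : Block ι κ,
    Fin (blockSize X Y b) × Fin (blockSize X Y b) => Q X C p.1 p.2.1 p.2.2) := by
  rw [linearIndependent_iff']
  rintro s g h ⟨b, t₁, t₂⟩ hp
  have h' := congrArg (fun x => Q X C b t₁ t₁ * x * Q X C b t₂ t₁) h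
  simp only [Finset.mul_sum, Finset.sum_mul, mul_zero, zero_mul, mul_smul_comm,
    smul_mul_assoc] at h'
  rw [Finset.sum_eq_single_of_mem _ hp] at h'
  · rw [Q_mul, if_pos rfl, Q_mul, if_pos rfl] at h'
    exact (smul_eq_zero.1 h').resolve_right (Q_self_ne_zero X C b t₁)
  · rintro ⟨b', t₃, t₄⟩ - hne
    by_cases hb : b = b'
    · subst hb
      rw [Q_mul]
      split_ifs with h1
      · subst h1
        rw [Q_mul, if_neg, smul_zero]
        rintro rfl
        exact hne rfl
      · rw [zero_mul, smul_zero]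
    · rw [Q_mul_of_ne X C hb, zero_mul, smul_zero]

/-- The refined Clebsch-Gordan basis. -/
def basisQ [Fintype ι] : Module.Basis (Σ b : Block ι κ, Fin (blockSize X Y b) × Fin (blockSize X Y b)) ℂ
    (KSym n) :=
  Module.Basis.mk (v := fun p => (⟨Q X C p.1 p.2.1 p.2.2, Q_mem X C _ _ _⟩ : KSym n))
    (LinearIndependent.of_comp (KSym n).toSubmodule.subtype (linearIndependent_Q X C)) (by
      intro x _
      have h := mem_spanQ X C x.2
      rw [spanQ] at h
      have h' : (KSym n).toSubmodule.subtype x ∈ (Submodule.span ℂ (Set.range fun p :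
          Σ b : Block ι κ, Fin (blockSize X Y b) × Fin (blockSize X Y b) =>
            (⟨Q X C p.1 p.2.1 p.2.2, Q_mem X C _ _ _⟩ : KSym n))).map
          (KSym n).toSubmodule.subtype := by
        rw [Submodule.map_span, ← Set.range_comp]
        exact h
      obtain ⟨y, hy, hyx⟩ := h'
      exact Subtype.val_injective hyx ▸ hy)

lemma coe_basisQ [Fintype ι] (b : Block ι κ) (t₁ t₂) : (basisQ X C ⟨b, t₁, t₂⟩ : Tri n) = Q X C b t₁ t₂ := by
  rw [basisQ, Module.Basis.mk_apply]

end Span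

/-! ### Sums over block labels -/

section BlockSum

variable {ι κ : Type*} [LinearOrder ι]

/-- Blocks as labels of four kinds. -/
def blockEquiv : Block ι κ ≃ {p : ι × ι × ι // p.1 < p.2.1 ∧ p.2.1 < p.2.2} ⊕
    ({p : ι × ι // p.1 ≠ p.2} ⊕ {p : ι × ι // p.1 ≠ p.2}) ⊕ ι × κ where
  toFun
    | .three R S T h => .inl ⟨(R, S, T), h⟩
    | .sym R S h => .inr (.inl (.inl ⟨(R, S), h⟩))
    | .alt R S h => .inr (.inl (.inr ⟨(R, S), h⟩))
    | .cube R L => .inr (.inr (R, L))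
  invFun
    | .inl p => .three p.1.1 p.1.2.1 p.1.2.2 p.2
    | .inr (.inl (.inl p)) => .sym p.1.1 p.1.2 p.2
    | .inr (.inl (.inr p)) => .alt p.1.1 p.1.2 p.2
    | .inr (.inr p) => .cube p.1 p.2
  left_inv b := by cases b <;> rfl
  right_inv p := by rcases p with p | (p | p) | p <;> rfl

instance [Finite ι] [Finite κ] : Finite (Block ι κ) := Finite.of_equiv _ blockEquiv.symm

/-- The functions `f₁`, `f₂`, `f₃` are defined on all tuples, so sums over labels carrying proofs
become the filtered sums of the dimension formula. -/
lemma sum_block [Fintype ι] [Fintype κ] [Fintype (Block ι κ)]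
    [DecidablePred fun p : ι × ι × ι => p.1 < p.2.1 ∧ p.2.1 < p.2.2]
    [DecidablePred fun p : ι × ι => p.1 ≠ p.2] (f : Block ι κ → ℕ)
    (f₁ : ι × ι × ι → ℕ) (f₂ f₃ : ι × ι → ℕ)
    (h₁ : ∀ R S T h, f (.three R S T h) = f₁ (R, S, T)) (h₂ : ∀ R S h, f (.sym R S h) = f₂ (R, S))
    (h₃ : ∀ R S h, f (.alt R S h) = f₃ (R, S)) :
    ∑ b, f b = (∑ p : ι × ι × ι with p.1 < p.2.1 ∧ p.2.1 < p.2.2, f₁ p) +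
      (∑ p : ι × ι with p.1 ≠ p.2, (f₂ p + f₃ p)) + ∑ R, ∑ L, f (.cube R L) := by
  rw [← blockEquiv.symm.sum_comp, Fintype.sum_sum_type, Fintype.sum_sum_type,
    Fintype.sum_sum_type, Fintype.sum_prod_type, Finset.sum_add_distrib, ← add_assoc,
    ← Finset.sum_subtype_eq_sum_filter, ← Finset.sum_subtype_eq_sum_filter,
    ← Finset.sum_subtype_eq_sum_filter, Finset.subtype_univ, Finset.subtype_univ]
  congr 2
  · exact Finset.sum_congr rfl fun p _ => h₁ _ _ _ _
  · congr 1
    · exact Finset.sum_congr rfl fun p _ => h₂ _ _ _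
    · exact Finset.sum_congr rfl fun p _ => h₃ _ _ _

end BlockSum

/-! ### The Wedderburn isomorphism and the main theorem -/

section Wedderburn

variable {n : ℕ} {ι κ : Type*} (X : IrrepSystem (Equiv.Perm (Fin n)) ι) [LinearOrder ι]
  [Fintype ι] [Fintype κ] {Y : IrrepSystem (Equiv.Perm (Fin 3)) κ} (C : CGSystem X Y)


lemma map_mul_of_basis {A B σ : Type*} [NonUnitalRing A] [Module ℂ A] [IsScalarTower ℂ A A]
    [SMulCommClass ℂ A A] [NonUnitalRing B] [Module ℂ B] [IsScalarTower ℂ B B]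
    [SMulCommClass ℂ B B] (v : Module.Basis σ ℂ A) (F : A →ₗ[ℂ] B)
    (h : ∀ s t, F (v s * v t) = F (v s) * F (v t)) (x y : A) : F (x * y) = F x * F y := by
  have key : (LinearMap.mul ℂ A).compr₂ F = (LinearMap.mul ℂ B).compl₁₂ F F :=
    v.ext fun s => v.ext fun t => by simpa using h s t
  simpa using LinearMap.congr_fun₂ key x y

-- The map is defined by sending basis to basis, so bilinearity reduces multiplicativity to the
-- matrix unit relations. The unit needs no separate check: a surjective multiplicative map carries
-- it to the unit.
open scoped Classical in
theorem exists_wedderburn : ∃ F : KSym n ≃ₗ[ℂ]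
      ((b : Block ι κ) → Matrix (Fin (blockSize X Y b)) (Fin (blockSize X Y b)) ℂ),
    (∀ x y, F (x * y) = F x * F y) ∧
    ∀ b t₁ t₂, F (basisQ X C ⟨b, t₁, t₂⟩) = Pi.single b (Matrix.single t₁ t₂ 1) := by
  have := Fintype.ofFinite (Block ι κ)
  let M := Pi.basis fun b : Block ι κ =>
    Matrix.stdBasis ℂ (Fin (blockSize X Y b)) (Fin (blockSize X Y b))
  have hM : ∀ b t₁ t₂, M ⟨b, t₁, t₂⟩ = Pi.single b (Matrix.single t₁ t₂ 1) := fun b t₁ t₂ => by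
    rw [Pi.basis_apply, Matrix.stdBasis_eq_single]
  let F := (basisQ X C).equiv M (Equiv.refl _)
  have hF : ∀ b t₁ t₂, F (basisQ X C ⟨b, t₁, t₂⟩) = Pi.single b (Matrix.single t₁ t₂ 1) :=
    fun b t₁ t₂ => by rw [Module.Basis.equiv_apply, Equiv.refl_apply, hM]
  refine ⟨F, fun x y => map_mul_of_basis (basisQ X C) F.toLinearMap ?_ x y, hF⟩
  rintro ⟨b, t₁, t₂⟩ ⟨b', t₃, t₄⟩
  simp only [LinearEquiv.coe_coe, hF]
  by_cases hb : b = b'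
  · subst hb
    have h : basisQ X C ⟨b, t₁, t₂⟩ * basisQ X C ⟨b, t₃, t₄⟩ =
        if t₂ = t₃ then basisQ X C ⟨b, t₁, t₄⟩ else 0 := by
      apply Subtype.val_injective
      refine Eq.trans ?_ ((Q_mul X C b t₁ t₂ t₃ t₄).trans ?_)
      · rw [← coe_basisQ, ← coe_basisQ]; rfl
      · split_ifs
        · rw [coe_basisQ]
        · rfl
    rw [h, ← Pi.single_mul]
    split_ifs with ht
    · subst ht
      rw [hF, Matrix.single_mul_single_same, one_mul]
    · rw [map_zero, Matrix.single_mul_single_of_ne _ _ _ _ ht, Pi.single_zero]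
  · have h : basisQ X C ⟨b, t₁, t₂⟩ * basisQ X C ⟨b', t₃, t₄⟩ = 0 := by
      apply Subtype.val_injective
      refine Eq.trans ?_ (Q_mul_of_ne X C hb t₁ t₂ t₃ t₄)
      rw [← coe_basisQ, ← coe_basisQ]; rfl
    rw [h, map_zero]
    ext b'' : 1
    rw [Pi.mul_apply, Pi.zero_apply]
    by_cases h1 : b'' = b
    · subst h1
      rw [Pi.single_eq_of_ne hb, mul_zero]
    · rw [Pi.single_eq_of_ne h1, zero_mul]

end Wedderburn

end ColourSym

end

open ColourSym in
open scoped Classical in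
theorem mainTheorem7 (n : ℕ) {ι κ : Type*} [Fintype ι] [LinearOrder ι] [Fintype κ]
    (X : IrrepSystem (Equiv.Perm (Fin n)) ι) (Y : IrrepSystem (Equiv.Perm (Fin 3)) κ) :
    -- the dimension as a sum of squares
    (Module.finrank ℂ (KSym n) =
      (∑ p : ι × ι × ι with p.1 < p.2.1 ∧ p.2.1 < p.2.2, kron X p.1 p.2.1 p.2.2 ^ 2) +
      (∑ p : ι × ι with p.1 ≠ p.2, (multSym X p.1 p.2 ^ 2 + multAlt X p.1 p.2 ^ 2)) +
      ∑ R : ι, ∑ L : κ, multCube X Y R L ^ 2) ∧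
    -- refined Clebsch-Gordan coefficients exist
    Nonempty (CGSystem X Y) ∧
    -- each choice of them gives a basis of matrix units and a Wedderburn-Artin decomposition
    ∀ C : CGSystem X Y,
      ∃ (B : Module.Basis (Σ b : Block ι κ, Fin (blockSize X Y b) × Fin (blockSize X Y b)) ℂ
            (KSym n))
        (F : KSym n ≃ₗ[ℂ]
          ((b : Block ι κ) → Matrix (Fin (blockSize X Y b)) (Fin (blockSize X Y b)) ℂ)),
        (∀ b t₁ t₂, (B ⟨b, t₁, t₂⟩ : Tri n) = Q X C b t₁ t₂) ∧
        (∀ x y, F (x * y) = F x * F y) ∧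
        (∀ b t₁ t₂, F (B ⟨b, t₁, t₂⟩) = Pi.single b (Matrix.single t₁ t₂ 1)) := by
  obtain ⟨C₀⟩ := exists_CGSystem X Y isConj_inv
  refine ⟨?_, ⟨C₀⟩, fun C => ?_⟩
  -- The dimension does not depend on the coefficients, so it is counted with the basis from the one
  -- choice `C₀`.
  · have := Fintype.ofFinite (Block ι κ)
    rw [Module.finrank_eq_card_basis (basisQ X C₀), Fintype.card_sigma]
    simp only [Fintype.card_prod, Fintype.card_fin, ← sq]
    exact sum_block (fun b => blockSize X Y b ^ 2) (fun p => kron X p.1 p.2.1 p.2.2 ^ 2)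
      (fun p => multSym X p.1 p.2 ^ 2) (fun p => multAlt X p.1 p.2 ^ 2)
      (fun _ _ _ _ => rfl) (fun _ _ _ => rfl) fun _ _ _ => rfl
  · obtain ⟨F, hmul, hF⟩ := exists_wedderburn X C
    exact ⟨basisQ X C, F, coe_basisQ X C, hmul, hF⟩
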